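/- There is an absolute constant $c>0$ such that the following holds. Let $n\ge 0$ and $k\ge 1$ be integers, let $T\subset\mathbb{R}^n$ be compact, and let $f=(f(t))_{t\in T}$ be a mean-zero Gaussian process whose covariance function $C(s,t)=\mathbb{E}[f(s)f(t)]$ is Lipschitz on $T\times T$. Let $D_C(s,t)=\big(\mathbb{E}(f(s)-f(t))^2\big)^{1/2}$ be its canonical pseudometric, let $\Delta=\operatorname{diam}(T,D_C)=\sup_{s,t\in T}D_C(s,t)$ (with $\Delta=0$ if $T=\emptyset$), and for $\epsilon>0$ let $\mathcal{N}(T,D_C;\epsilon)$ be the smallest number of closed $D_C$-balls of radius $\epsilon$ with centers in $T$ that cover $T$. Let $f_1,\dots,f_k$ be independent copies of $f$ on a probability space, and let $$h^k(x)=\frac{1}{\sqrt k}\,(f_1(x),\dots,f_k(x))\in\mathbb{R}^k,\qquad x\in T.$$ Then $\Delta<\infty$, $\mathcal{N}(T,D_C;\epsilon)<\infty$ for every $\epsilon>0$, the function $\epsilon\mapsto\log(\mathcal{N}(T,D_C;\epsilon)+1)$ is integrable on $(0,\Delta)$, and for every countable set $S\subseteq T$ $$\mathbb{E}\sup_{x,y\in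 S}\Big|\,\|h^k(x)-h^k(y)\|^2-D_C(x,y)^2\Big|\;\le\;\frac{c\,\Delta}{\sqrt k}\int_0^{\Delta}\log\big(\mathcal{N}(T,D_C;\epsilon)+1\big)\,d\epsilon .$$ Moreover, if $f_1,\dots,f_k$ almost surely have continuous sample paths, then the supremum over all $x,y\in T$ is a random variable (measurable with respect to the completed $\sigma$-algebra), and $$\mathbb{E}\sup_{x,y\in T}\Big|\,\|h^k(x)-h^k(y)\|^2-D_C(x,y)^2\Big|\;\le\;\frac{c\,\Delta}{\sqrt k}\int_0^{\Delta}\log\big(\mathcal{N}(T,D_C;\epsilon)+1\big)\,d\epsilon .$$ (Suprema over the empty set are $0$.) -/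

import Mathlib

open MeasureTheory ProbabilityTheory
open scoped ENNReal NNReal

noncomputable section

namespace GPEmbedding

/-- The covariance function `C(s,t) = E[f(s) f(t)]` of a zero-mean random process. -/
def covFun {T Ω : Type*} [MeasurableSpace Ω] (f : T → Ω → ℝ) (P : Measure Ω) (s t : T) : ℝ :=
  ∫ ω, f s ω * f t ω ∂P

/-- The canonical (pseudo)metric `D_C(s,t) = (E (f(s) - f(t))²)^{1/2}` of a random process. -/
def canonicalDist {T Ω : Type*} [MeasurableSpace Ω] (f : T → Ω → ℝ) (P : Measure Ω)
    (s t : T) : ℝ :=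
  √(∫ ω, (f s ω - f t ω) ^ 2 ∂P)

/-- The diameter `sup_{s,t} d(s,t)` of a space `T` for a pseudometric `d`, here an explicit
function (the supremum is that of a bounded set whenever it is used, and it is `0` for empty
`T`). -/
def diam {T : Type*} (d : T → T → ℝ) : ℝ := ⨆ p : T × T, d p.1 p.2

/-- The covering number `𝒩(T,d;ε)`: the smallest number of (closed) balls of radius `ε`,
with centers in `T`, whose union is `T`; it is `⊤` if there is no finite covering. -/
def coveringNumber {T : Type*} (d : T → T → ℝ) (ε : ℝ) : ℕ∞ :=
  ⨅ (A : Set T) (_ : ∀ x, ∃ y ∈ A, d x y ≤ ε), A.encard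

/-- The entropy integrand `log (𝒩(T,d;ε) + 1)`. -/
def logEntropy {T : Type*} (d : T → T → ℝ) (ε : ℝ) : ℝ :=
  Real.log (((coveringNumber d ε).toNat : ℝ) + 1)

/-- The random map `h^k(x) = k^{-1/2} (f₁(x), …, f_k(x))` into Euclidean space `ℝᵏ`. -/
def embed {T Ω : Type*} {k : ℕ} (F : Fin k → T → Ω → ℝ) (x : T) (ω : Ω) :
    EuclideanSpace ℝ (Fin k) :=
  (1 / √(k : ℝ)) • WithLp.toLp 2 (fun i => F i x ω)

/-- `f₁, …, f_k` are independent copies of the process `f`: as random elements of `T → ℝ` with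
the product σ-algebra, they are independent and each has the law of `f`. -/
structure IsIndepCopies {T Ω Ω' : Type*} [MeasurableSpace Ω] [MeasurableSpace Ω'] {k : ℕ}
    (F : Fin k → T → Ω → ℝ) (P : Measure Ω) (f : T → Ω' → ℝ) (P' : Measure Ω') : Prop where
  identDistrib : ∀ i, IdentDistrib (fun ω t => F i t ω) (fun ω t => f t ω) P P'
  indep : iIndepFun (fun i ω t => F i t ω) P

/-- The random variable `sup_{x,y ∈ S} | ‖h^k(x) - h^k(y)‖² - D(x,y)² |`, with values in
`[0,∞]`. -/
def supDeviation {T Ω : Type*} {k : ℕ} (F : Fin k → T → Ω → ℝ) (D : T → T → ℝ) (S : Set T)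
    (ω : Ω) : ℝ≥0∞ :=
  ⨆ (x ∈ S) (y ∈ S), ENNReal.ofReal |‖embed F x ω - embed F y ω‖ ^ 2 - D x y ^ 2|

/-- The quantity `diam(T,D) / √k · ∫₀^{diam(T,D)} log (𝒩(T,D;ε) + 1) dε`. -/
def entropyBound {T : Type*} (D : T → T → ℝ) (k : ℕ) : ℝ :=
  diam D / √(k : ℝ) * ∫ ε in (0 : ℝ)..diam D, logEntropy D ε

end GPEmbedding

end

namespace GPEmbedding

/-! The deviation `Z(x,y) = ‖h^k(x) - h^k(y)‖² - D(x,y)²` is an average of `k` i.i.d. centered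
variables, and the proof is a chaining argument for `Z` on pairs. Put `a = f(x') - f(y')` and `b =
f(x) - f(y)`. An increment of `Z` averages centered copies of `a² - b² = (a - b)(a + b)`. If `x', x`
and `y', y` are `ε`-close, the Gaussian `a - b` has standard deviation at most `2ε`, while `a + b`
has at most `2Δ`. The product is sub-exponential at scale `εΔ`, and averaging gains `1/√k`
(`lintegral_exp_deviation_increment_le`). Exponential rather than Gaussian tails make a maximum over
`N` increments cost `log (N + 1)` (`lintegral_iSup_abs_le`), hence the integrand `log (𝒩 + 1)`
without a square root.

Chaining runs over nets at scales `Δ/2^j`, starting from one point, where `Z` vanishes. A link is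
determined by four net points, so level `j` costs a constant times `(Δ/√k) (Δ/2^j) log (𝒩(Δ/2^(j+1))
+ 1)`, and `sum_dyadic_logEntropy_le` sums these against the integral. For a finite index set the
remainder vanishes as the number of scales grows; monotone convergence gives countable sets and path
continuity gives all of `T`.

The Lipschitz covariance gives `D(s,t)² ≤ 2L dist(s,t)`, so covering numbers grow polynomially in
`1/ε` and their logarithm is integrable at `0`. -/

/-! ### Exponential moments of Gaussian products and of averages -/

/-- Against the density of variance `v`, the weight `exp (x²/(4v))` leaves `exp (-x²/(4v))`, with
integral `√2`; a larger `s²` only lowers the weight. Variance `0` is the Dirac case. -/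
lemma integrable_exp_sq_gaussianReal {v : ℝ≥0} {s : ℝ} (hv : (v : ℝ) ≤ s ^ 2) :
    Integrable (fun x => Real.exp (x ^ 2 / (4 * s ^ 2))) (gaussianReal 0 v) ∧
      ∫ x, Real.exp (x ^ 2 / (4 * s ^ 2)) ∂(gaussianReal 0 v) ≤ 2 := by
  by_cases h0 : v = 0
  · subst h0
    rw [gaussianReal_zero_var]
    refine ⟨integrable_dirac (by simp), ?_⟩
    rw [integral_dirac]
    simp
  have hv0 : (0 : ℝ) < v := by positivity
  have hprod : ∀ x : ℝ, gaussianPDFReal 0 v x • Real.exp (x ^ 2 / (4 * v)) =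
      (√(2 * Real.pi * v))⁻¹ * Real.exp (-(1 / (4 * v)) * x ^ 2) := by
    intro x
    rw [gaussianPDFReal, smul_eq_mul, mul_assoc, ← Real.exp_add]
    congr 2
    field_simp
    ring
  have hint : Integrable (fun x => Real.exp (x ^ 2 / (4 * v))) (gaussianReal 0 v) := by
    rw [gaussianReal_of_var_ne_zero _ h0]
    unfold gaussianPDF
    rw [integrable_withDensity_iff_integrable_smul₀' (by fun_prop) (by simp)]
    have := (integrable_exp_neg_mul_sq (b := 1 / (4 * (v : ℝ))) (by positivity)).const_mul
      ((√(2 * Real.pi * v))⁻¹)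
    refine this.congr (ae_of_all _ fun x => ?_)
    change _ * _ = _
    rw [← hprod x]
    simp [ENNReal.toReal_ofReal (gaussianPDFReal_nonneg 0 v x)]
  have hval : ∫ x, Real.exp (x ^ 2 / (4 * v)) ∂(gaussianReal 0 v) ≤ 2 := by
    rw [integral_gaussianReal_eq_integral_smul h0]
    simp_rw [hprod]
    rw [integral_const_mul, integral_gaussian, ← Real.sqrt_inv, ← Real.sqrt_mul (by positivity)]
    have : (2 * Real.pi * (v : ℝ))⁻¹ * (Real.pi / (1 / (4 * v))) = 2 := by
      field_simp
      ring
    rw [this]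
    exact Real.sqrt_le_iff.2 (by norm_num)
  have hle : ∀ x : ℝ, Real.exp (x ^ 2 / (4 * s ^ 2)) ≤ Real.exp (x ^ 2 / (4 * v)) := by
    intro x
    gcongr
  have hint' : Integrable (fun x => Real.exp (x ^ 2 / (4 * s ^ 2))) (gaussianReal 0 v) :=
    hint.mono' (by fun_prop) (ae_of_all _ fun x => by
      rw [Real.norm_of_nonneg (Real.exp_pos _).le]; exact hle x)
  exact ⟨hint', (integral_mono hint' hint hle).trans hval⟩

lemma exp_le_one_add_self_add_sq_mul_exp_abs (x : ℝ) :
    Real.exp x ≤ 1 + x + x ^ 2 * Real.exp |x| := by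
  have h := Complex.norm_exp_sub_sum_le_norm_mul_exp (x : ℂ) 2
  rw [← Complex.ofReal_exp] at h
  simp only [Finset.sum_range_succ, Finset.sum_range_zero] at h
  norm_num at h
  rw [← Complex.ofReal_one, ← Complex.ofReal_add, ← Complex.ofReal_exp, ← Complex.ofReal_sub,
    Complex.norm_real, Real.norm_eq_abs] at h
  linarith [le_abs_self (Real.exp x - (1 + x))]

/-- A centered variable with a bounded exponential moment has a sub-Gaussian moment generating
function near zero. -/
lemma mgf_le_of_integral_exp_abs_le {Ω : Type*} [MeasurableSpace Ω] {P : Measure Ω}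
    [IsProbabilityMeasure P] {Y : Ω → ℝ} {B μ : ℝ} (hY : AEMeasurable Y P)
    (hint : Integrable (fun ω => Real.exp (|Y ω| / 4)) P)
    (hB : ∫ ω, Real.exp (|Y ω| / 4) ∂P ≤ B) (h0 : ∫ ω, Y ω ∂P = 0) (hμ : |μ| ≤ 1 / 8) :
    Integrable (fun ω => Real.exp (μ * Y ω)) P ∧ mgf Y P μ ≤ Real.exp (128 * B * μ ^ 2) := by
  have habs : ∀ y : ℝ, |μ * y| ≤ |y| / 8 := fun y => by
    rw [abs_mul]; nlinarith [abs_nonneg y]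
  have hYint : Integrable Y P := by
    refine (hint.const_mul 4).mono' hY.aestronglyMeasurable (ae_of_all _ fun ω => ?_)
    rw [Real.norm_eq_abs]
    linarith [Real.add_one_le_exp (|Y ω| / 4)]
  have hI : Integrable (fun ω => Real.exp (μ * Y ω)) P := by
    refine hint.mono' (by fun_prop) (ae_of_all _ fun ω => ?_)
    rw [Real.norm_of_nonneg (Real.exp_pos _).le]
    have := habs (Y ω)
    gcongr
    linarith [le_abs_self (μ * Y ω), abs_nonneg (Y ω)]
  refine ⟨hI, ?_⟩
  have hpt : ∀ y : ℝ, Real.exp (μ * y) ≤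
      1 + μ * y + 128 * μ ^ 2 * Real.exp (|y| / 4) := by
    intro y
    refine (exp_le_one_add_self_add_sq_mul_exp_abs _).trans ?_
    -- From `z²/2 ≤ exp z` at `z = |y|/8`. One factor `exp (|y|/8)` pays for `y²`, the other for
    -- `exp |μ y|`; together they use up the available `exp (|y|/4)`.
    have h1 : y ^ 2 ≤ 128 * Real.exp (|y| / 8) := by
      have := Real.quadratic_le_exp_of_nonneg (x := |y| / 8) (by positivity)
      have h2 : |y| ^ 2 = y ^ 2 := sq_abs y
      nlinarith [abs_nonneg y]
    have h2 : Real.exp |μ * y| ≤ Real.exp (|y| / 8) := Real.exp_le_exp.2 (habs y)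
    have h3 : Real.exp (|y| / 4) = Real.exp (|y| / 8) * Real.exp (|y| / 8) := by
      rw [← Real.exp_add]; ring_nf
    have : (μ * y) ^ 2 * Real.exp |μ * y| ≤
        μ ^ 2 * (128 * Real.exp (|y| / 8)) * Real.exp (|y| / 8) := by
      rw [mul_pow]; gcongr
    rw [h3]; linarith
  have hexp : mgf Y P μ ≤ 1 + 128 * μ ^ 2 * B := by
    calc mgf Y P μ ≤ ∫ ω, (1 + μ * Y ω + 128 * μ ^ 2 * Real.exp (|Y ω| / 4)) ∂P :=
          integral_mono hI (((integrable_const _).add (hYint.const_mul _)).add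
            (hint.const_mul _)) fun ω => hpt (Y ω)
      _ = 1 + 128 * μ ^ 2 * ∫ ω, Real.exp (|Y ω| / 4) ∂P := by
          have e1 : Integrable (fun ω => 1 + μ * Y ω) P :=
            (integrable_const _).add (hYint.const_mul _)
          rw [integral_add e1 (hint.const_mul _),
            integral_add (integrable_const _) (hYint.const_mul _), integral_const_mul,
            integral_const_mul, h0]
          simp
      _ ≤ _ := by gcongr
  refine hexp.trans ?_
  linarith [Real.add_one_le_exp (128 * B * μ ^ 2)]

/-- The exponential moment of a centered product of two centered Gaussian variables. -/
lemma integral_exp_abs_centered_mul_le {Ω : Type*} [MeasurableSpace Ω] {P : Measure Ω}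
    [IsProbabilityMeasure P] {U V : Ω → ℝ} {v w : ℝ≥0} {s r : ℝ} (hs : 0 < s) (hr : 0 < r)
    (hU : HasLaw U (gaussianReal 0 v) P) (hV : HasLaw V (gaussianReal 0 w) P)
    (hv : (v : ℝ) ≤ s ^ 2) (hw : (w : ℝ) ≤ r ^ 2) {c : ℝ} (hc : |c| ≤ s * r) :
    Integrable (fun ω => Real.exp (|(U ω * V ω - c) / (s * r)| / 4)) P ∧
      ∫ ω, Real.exp (|(U ω * V ω - c) / (s * r)| / 4) ∂P ≤ 4 := by
  have key : ∀ {X : Ω → ℝ} {u : ℝ≥0} {q : ℝ}, HasLaw X (gaussianReal 0 u) P →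
      (u : ℝ) ≤ q ^ 2 → Integrable (fun ω => Real.exp (X ω ^ 2 / (4 * q ^ 2))) P ∧
        ∫ ω, Real.exp (X ω ^ 2 / (4 * q ^ 2)) ∂P ≤ 2 := by
    intro X u q hX hu
    obtain ⟨h1, h2⟩ := integrable_exp_sq_gaussianReal hu
    rw [← hX.map_eq] at h1 h2
    rw [integral_map hX.aemeasurable (by fun_prop)] at h2
    exact ⟨h1.comp_aemeasurable hX.aemeasurable, h2⟩
  obtain ⟨hU1, hU2⟩ := key hU hv
  obtain ⟨hV1, hV2⟩ := key hV hw
  have hUm := hU.aemeasurable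
  have hVm := hV.aemeasurable
  have hpt : ∀ ω, Real.exp (|(U ω * V ω - c) / (s * r)| / 4) ≤
      Real.exp (U ω ^ 2 / (4 * s ^ 2)) + Real.exp (V ω ^ 2 / (4 * r ^ 2)) := by
    intro ω
    set a := U ω / s with ha
    set b := V ω / r with hb
    have h1 : (U ω * V ω - c) / (s * r) = a * b - c / (s * r) := by
      rw [ha, hb]; field_simp
    have h2 : |c / (s * r)| ≤ 1 := by
      rw [abs_div, abs_of_pos (mul_pos hs hr), div_le_one (mul_pos hs hr)]; exact hc
    have h3 : |a * b| ≤ (a ^ 2 + b ^ 2) / 2 := by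
      rw [abs_le]; constructor <;> nlinarith [sq_nonneg (a - b), sq_nonneg (a + b)]
    have h4 : U ω ^ 2 / (4 * s ^ 2) = a ^ 2 / 4 := by rw [ha]; field_simp
    have h5 : V ω ^ 2 / (4 * r ^ 2) = b ^ 2 / 4 := by rw [hb]; field_simp
    rw [h1, h4, h5]
    have h6 : |a * b - c / (s * r)| / 4 ≤ 1 / 4 + a ^ 2 / 8 + b ^ 2 / 8 := by
      have := abs_sub (a * b) (c / (s * r))
      linarith
    refine (Real.exp_le_exp.2 h6).trans ?_
    -- With `p = exp (a²/8)` and `q = exp (b²/8)`, the claim is `exp (1/4) p q ≤ 2 p q ≤ p² + q²`.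
    have e1 : Real.exp (a ^ 2 / 4) = Real.exp (a ^ 2 / 8) ^ 2 := by
      rw [← Real.exp_nat_mul]; congr 1; push_cast; ring
    have e2 : Real.exp (b ^ 2 / 4) = Real.exp (b ^ 2 / 8) ^ 2 := by
      rw [← Real.exp_nat_mul]; congr 1; push_cast; ring
    have e3 : Real.exp (1 / 4) ≤ 2 := by
      have := Real.exp_bound_div_one_sub_of_interval (x := 1 / 4) (by norm_num) (by norm_num)
      norm_num at this ⊢
      linarith
    rw [Real.exp_add, Real.exp_add, e1, e2, mul_assoc]
    have hp := mul_pos (Real.exp_pos (a ^ 2 / 8)) (Real.exp_pos (b ^ 2 / 8))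
    nlinarith [sq_nonneg (Real.exp (a ^ 2 / 8) - Real.exp (b ^ 2 / 8))]
  have hI : Integrable (fun ω => Real.exp (|(U ω * V ω - c) / (s * r)| / 4)) P :=
    (hU1.add hV1).mono' (by
      apply AEMeasurable.aestronglyMeasurable
      apply Real.measurable_exp.comp_aemeasurable
      exact (continuous_abs.measurable.comp_aemeasurable
        (((hUm.mul hVm).sub_const c).div_const _)).div_const _) (ae_of_all _ fun ω => by
      rw [Real.norm_of_nonneg (Real.exp_pos _).le]; exact hpt ω)
  refine ⟨hI, (integral_mono hI (hU1.add hV1) hpt).trans ?_⟩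
  simp only [Pi.add_apply]
  rw [integral_add hU1 hV1]
  linarith

/-- Exponential moments of averages of independent centered sub-exponential variables. -/
lemma lintegral_exp_abs_average_le {Ω : Type*} [MeasurableSpace Ω] {P : Measure Ω}
    [IsProbabilityMeasure P] {k : ℕ} (hk : 0 < k) {Y : Fin k → Ω → ℝ} {B : ℝ}
    (hind : iIndepFun Y P) (hY : ∀ i, AEMeasurable (Y i) P)
    (hint : ∀ i, Integrable (fun ω => Real.exp (|Y i ω| / 4)) P)
    (hB : ∀ i, ∫ ω, Real.exp (|Y i ω| / 4) ∂P ≤ B) (h0 : ∀ i, ∫ ω, Y i ω ∂P = 0) :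
    ∫⁻ ω, ENNReal.ofReal (Real.exp (√k / 8 * |(1 / k : ℝ) * ∑ i, Y i ω|)) ∂P ≤
      ENNReal.ofReal (2 * Real.exp (2 * B)) := by
  have hk' : (0 : ℝ) < k := by exact_mod_cast hk
  have hk1 : (1 : ℝ) ≤ k := by exact_mod_cast hk
  have hsq : 0 < √(k : ℝ) := Real.sqrt_pos.2 hk'
  have hsq1 : 1 ≤ √(k : ℝ) := Real.one_le_sqrt.2 hk1
  -- At `μ = ±1/(8√k)` one has `|μ| ≤ 1/8`, and the `k` factors `exp (128 B μ²) = exp (2B/k)`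
  -- multiply to a bound free of `k`.
  have key : ∀ μ : ℝ, μ ^ 2 = 1 / (64 * k) →
      Integrable (fun ω => Real.exp (μ * ∑ i, Y i ω)) P ∧
        ∫ ω, Real.exp (μ * ∑ i, Y i ω) ∂P ≤ Real.exp (2 * B) := by
    intro μ hμ
    have hμ8 : |μ| ≤ 1 / 8 := by
      refine abs_le_of_sq_le_sq (b := (1 / 8 : ℝ)) ?_ (by norm_num)
      rw [hμ, div_le_iff₀ (by positivity)]
      nlinarith
    have hmgf := hind.mgf_sum₀ hY Finset.univ (t := μ)
    have heach := fun i => mgf_le_of_integral_exp_abs_le (hY i) (hint i) (hB i) (h0 i) hμ8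
    have hpos : 0 < mgf (∑ i, Y i) P μ := by
      rw [hmgf]
      exact Finset.prod_pos fun i _ => mgf_pos (heach i).1
    have hfun : (fun ω => Real.exp (μ * ∑ i, Y i ω)) =
        fun ω => Real.exp (μ * (∑ i, Y i) ω) := by
      ext ω; simp
    rw [hfun]
    refine ⟨?_, ?_⟩
    -- A non-integrable exponential would have Bochner integral `0`, but this moment generating
    -- function is a product of positive ones.
    · by_contra hcon
      exact hpos.ne' (integral_undef hcon)
    · change mgf (∑ i, Y i) P μ ≤ _
      rw [hmgf]
      calc ∏ i, mgf (Y i) P μ ≤ ∏ _i : Fin k, Real.exp (128 * B * μ ^ 2) :=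
            Finset.prod_le_prod (fun _ _ => mgf_nonneg) fun i _ => (heach i).2
        _ = Real.exp (2 * B) := by
            rw [Finset.prod_const, Finset.card_univ, Fintype.card_fin, ← Real.exp_nat_mul, hμ]
            congr 1
            field_simp
            ring
  have hsqk : √(k : ℝ) ^ 2 = k := Real.sq_sqrt hk'.le
  have hμ2 : (1 / (8 * √(k : ℝ))) ^ 2 = 1 / (64 * k) := by
    rw [div_pow, mul_pow, hsqk]; norm_num
  obtain ⟨i1, b1⟩ := key (1 / (8 * √k)) hμ2
  obtain ⟨i2, b2⟩ := key (-(1 / (8 * √k))) (by rw [neg_sq, hμ2])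
  calc _ ≤ ∫⁻ ω, ENNReal.ofReal (Real.exp (1 / (8 * √k) * ∑ i, Y i ω) +
          Real.exp (-(1 / (8 * √k)) * ∑ i, Y i ω)) ∂P := by
        refine lintegral_mono fun ω => ENNReal.ofReal_le_ofReal ?_
        set S := ∑ i, Y i ω
        have : √(k : ℝ) / 8 * |(1 / k : ℝ) * S| = |1 / (8 * √k) * S| := by
          rw [abs_mul, abs_mul, abs_of_pos (by positivity : (0 : ℝ) < 1 / k),
            abs_of_pos (by positivity : (0 : ℝ) < 1 / (8 * √k))]
          have : 1 / (8 * √(k : ℝ)) = √k / (8 * k) := by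
            rw [div_eq_div_iff (by positivity) (by positivity)]; nlinarith
          rw [this]; field_simp
        rw [this, neg_mul]
        rcases abs_cases (1 / (8 * √(k : ℝ)) * S) with ⟨h, _⟩ | ⟨h, _⟩ <;> rw [h]
        · linarith [Real.exp_pos (-(1 / (8 * √k) * S))]
        · linarith [Real.exp_pos (1 / (8 * √k) * S)]
    _ = ENNReal.ofReal (∫ ω, (Real.exp (1 / (8 * √k) * ∑ i, Y i ω) +
          Real.exp (-(1 / (8 * √k)) * ∑ i, Y i ω)) ∂P) := by
        exact (ofReal_integral_eq_lintegral_ofReal (i1.add i2)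
          (ae_of_all _ fun ω => by simp only [Pi.add_apply, Pi.zero_apply]; positivity)).symm
    _ ≤ _ := by
        refine ENNReal.ofReal_le_ofReal ?_
        rw [integral_add i1 i2]
        linarith

/-! ### Maximal inequality -/

/-- A maximal inequality for finitely many variables with bounded exponential moments. -/
lemma lintegral_iSup_abs_le {Ω ι : Type*} [MeasurableSpace Ω] {P : Measure Ω}
    [IsProbabilityMeasure P] (Q : Finset ι) {X : ι → Ω → ℝ} {lam K : ℝ}
    (hlam : 0 < lam) (hK : 0 ≤ K) (hX : ∀ q ∈ Q, AEMeasurable (X q) P)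
    (h : ∀ q ∈ Q, ∫⁻ ω, ENNReal.ofReal (Real.exp (lam * |X q ω|)) ∂P ≤ ENNReal.ofReal K) :
    ∫⁻ ω, ⨆ q ∈ Q, ENNReal.ofReal |X q ω| ∂P ≤
      ENNReal.ofReal ((1 + 2 * K) / lam * Real.log (Q.card + 1)) := by
  rcases Q.eq_empty_or_nonempty with rfl | hne
  · simp
  set a : ℝ := Q.card + 1 with ha
  have hM : (1 : ℝ) ≤ Q.card := by exact_mod_cast hne.card_pos
  have ha0 : 0 < a := by positivity
  -- This absorbs the additive `K` into `2 K log a`, whence the factor `1 + 2 * K`.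
  have hloga : 1 / 2 ≤ Real.log a := by
    have : Real.log 2 ≤ Real.log a := Real.log_le_log (by norm_num) (by linarith)
    linarith [Real.log_two_gt_d9]
  have hpt : ∀ ω, ⨆ q ∈ Q, ENNReal.ofReal |X q ω| ≤ ENNReal.ofReal (Real.log a / lam) +
      ∑ q ∈ Q, ENNReal.ofReal (1 / (a * lam)) * ENNReal.ofReal (Real.exp (lam * |X q ω|)) := by
    intro ω
    refine iSup₂_le fun q hq => ?_
    -- This is `u + 1 ≤ exp u` at `u = lam |X| - log a`; the weight `1/a` makes the sum over `Q` of
    -- the exponential moments at most `K`.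
    have h1 : |X q ω| ≤ Real.log a / lam + 1 / (a * lam) * Real.exp (lam * |X q ω|) := by
      have := Real.add_one_le_exp (lam * |X q ω| - Real.log a)
      rw [Real.exp_sub, Real.exp_log ha0] at this
      have e : Real.log a / lam + 1 / (a * lam) * Real.exp (lam * |X q ω|) =
          (Real.log a + Real.exp (lam * |X q ω|) / a) / lam := by field_simp
      rw [e, le_div_iff₀ hlam]
      linarith
    calc ENNReal.ofReal |X q ω| ≤ ENNReal.ofReal (Real.log a / lam) +
          ENNReal.ofReal (1 / (a * lam)) * ENNReal.ofReal (Real.exp (lam * |X q ω|)) := by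
          rw [← ENNReal.ofReal_mul (by positivity), ← ENNReal.ofReal_add (by positivity)
            (by positivity)]
          exact ENNReal.ofReal_le_ofReal h1
      _ ≤ _ := by
          refine add_le_add le_rfl ?_
          exact Finset.single_le_sum (f := fun q => ENNReal.ofReal (1 / (a * lam)) *
            ENNReal.ofReal (Real.exp (lam * |X q ω|))) (fun _ _ => zero_le) hq
  have hm : ∀ q ∈ Q, AEMeasurable (fun ω => ENNReal.ofReal (Real.exp (lam * |X q ω|))) P :=
    fun q hq => (Real.measurable_exp.comp_aemeasurable
      ((continuous_abs.measurable.comp_aemeasurable (hX q hq)).const_mul lam)).ennreal_ofReal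
  calc _ ≤ ∫⁻ ω, (ENNReal.ofReal (Real.log a / lam) + ∑ q ∈ Q,
          ENNReal.ofReal (1 / (a * lam)) * ENNReal.ofReal (Real.exp (lam * |X q ω|))) ∂P :=
        lintegral_mono hpt
    _ = ENNReal.ofReal (Real.log a / lam) + ∑ q ∈ Q, ENNReal.ofReal (1 / (a * lam)) *
          ∫⁻ ω, ENNReal.ofReal (Real.exp (lam * |X q ω|)) ∂P := by
        rw [lintegral_add_left measurable_const, lintegral_const, measure_univ, mul_one,
          lintegral_finsetSum' _ fun q hq => (hm q hq).const_mul _]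
        congr 1
        exact Finset.sum_congr rfl fun q hq => lintegral_const_mul'' _ (hm q hq)
    _ ≤ ENNReal.ofReal (Real.log a / lam) + ∑ q ∈ Q, ENNReal.ofReal (1 / (a * lam)) *
          ENNReal.ofReal K := by
        refine add_le_add le_rfl (Finset.sum_le_sum fun q hq => ?_)
        exact mul_le_mul_right (h q hq) _
    _ = ENNReal.ofReal (Real.log a / lam + Q.card * (1 / (a * lam) * K)) := by
        rw [Finset.sum_const, nsmul_eq_mul, ← ENNReal.ofReal_mul (by positivity),
          ← ENNReal.ofReal_natCast, ← ENNReal.ofReal_mul (by positivity),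
          ← ENNReal.ofReal_add (by positivity) (by positivity)]
    _ ≤ _ := by
        refine ENNReal.ofReal_le_ofReal ?_
        have e : (Q.card : ℝ) * (1 / (a * lam) * K) = (Q.card / a) * K / lam := by field_simp
        have e2 : (Q.card : ℝ) / a ≤ 1 := by rw [div_le_one ha0]; linarith
        rw [e, ← add_div, div_mul_eq_mul_div (1 + 2 * K)]
        refine div_le_div_of_nonneg_right ?_ hlam.le
        nlinarith

/-! ### The deviation and the canonical distance -/

/-- The deviation `‖h^k(x) - h^k(y)‖² - D(x,y)²`. -/
noncomputable def deviation {T Ω : Type*} {k : ℕ} (F : Fin k → T → Ω → ℝ) (D : T → T → ℝ) (x y : T)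
    (ω : Ω) : ℝ :=
  ‖embed F x ω - embed F y ω‖ ^ 2 - D x y ^ 2

lemma deviation_eq_average {T Ω : Type*} {k : ℕ} (hk : 0 < k) (F : Fin k → T → Ω → ℝ)
    (D : T → T → ℝ) (x y : T) (ω : Ω) :
    deviation F D x y ω = (1 / k : ℝ) * ∑ i, ((F i x ω - F i y ω) ^ 2 - D x y ^ 2) := by
  have hk' : (0 : ℝ) < k := by exact_mod_cast hk
  rw [deviation, embed, embed, ← smul_sub, norm_smul, mul_pow, EuclideanSpace.norm_sq_eq,
    Finset.sum_sub_distrib]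
  simp only [Finset.sum_const, Finset.card_univ, Fintype.card_fin, nsmul_eq_mul, PiLp.sub_apply,
    Real.norm_eq_abs, sq_abs]
  rw [div_pow, Real.sq_sqrt hk'.le]
  field_simp

lemma canonicalDist_nonneg {T Ω : Type*} [MeasurableSpace Ω] (f : T → Ω → ℝ) (P : Measure Ω)
    (s t : T) : 0 ≤ canonicalDist f P s t :=
  Real.sqrt_nonneg _

lemma canonicalDist_self {T Ω : Type*} [MeasurableSpace Ω] (f : T → Ω → ℝ) (P : Measure Ω)
    (s : T) : canonicalDist f P s s = 0 := by
  simp [canonicalDist]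

lemma canonicalDist_comm {T Ω : Type*} [MeasurableSpace Ω] (f : T → Ω → ℝ) (P : Measure Ω)
    (s t : T) : canonicalDist f P s t = canonicalDist f P t s := by
  unfold canonicalDist
  congr 2
  ext ω
  ring

lemma sq_canonicalDist {T Ω : Type*} [MeasurableSpace Ω] (f : T → Ω → ℝ) (P : Measure Ω)
    (s t : T) : canonicalDist f P s t ^ 2 = ∫ ω, (f s ω - f t ω) ^ 2 ∂P :=
  Real.sq_sqrt (integral_nonneg fun _ => sq_nonneg _)

/-! ### Increments of the deviation -/

section Increments

variable {T Ω' : Type*} [MeasurableSpace Ω'] {P' : Measure Ω'} {f : T → Ω' → ℝ}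

/-- Indexing by pairs makes sums and differences of two increments Gaussian at once. -/
lemma isGaussianProcess_increments (hf : IsGaussianProcess f P') :
    IsGaussianProcess (fun (p : T × T) ω => f p.1 ω - f p.2 ω) P' := by
  classical
  refine hf.of_isGaussianProcess fun p => ⟨{p.1, p.2},
    ContinuousLinearMap.proj ⟨p.1, by simp⟩ - ContinuousLinearMap.proj ⟨p.2, by simp⟩, ?_⟩
  intro ω
  simp

lemma integrable_mul_of_isGaussianProcess (hf : IsGaussianProcess f P') (s t : T) :
    Integrable (fun ω => f s ω * f t ω) P' :=
  MemLp.integrable_mul (hf.hasGaussianLaw_eval s).memLp_two (hf.hasGaussianLaw_eval t).memLp_two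

lemma integrable_sq_increment (hf : IsGaussianProcess f P') (s t : T) :
    Integrable (fun ω => (f s ω - f t ω) ^ 2) P' :=
  ((isGaussianProcess_increments hf).hasGaussianLaw_eval (s, t)).memLp_two.integrable_sq

lemma hasLaw_gaussianReal_of_sq_le [IsProbabilityMeasure P'] {U : Ω' → ℝ} {s : ℝ}
    (hU : HasGaussianLaw U P') (h0 : ∫ ω, U ω ∂P' = 0) (hs : ∫ ω, U ω ^ 2 ∂P' ≤ s ^ 2) :
    ∃ v : ℝ≥0, (v : ℝ) ≤ s ^ 2 ∧ HasLaw U (gaussianReal 0 v) P' := by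
  refine ⟨Var[U; P'].toNNReal, ?_, hU.aemeasurable, ?_⟩
  · rw [Real.coe_toNNReal _ (variance_nonneg _ _)]
    exact (variance_le_expectation_sq hU.aemeasurable.aestronglyMeasurable).trans hs
  · rw [hU.map_eq_gaussianReal, h0]

/-- The moment bounds for the product of the difference and the sum of two increments. -/
lemma exists_hasLaw_increments [IsProbabilityMeasure P'] (hf : IsGaussianProcess f P')
    (h0 : ∀ t, ∫ ω, f t ω ∂P' = 0) {ε δ : ℝ} {x' y' x y : T}
    (hx : canonicalDist f P' x' x ≤ ε) (hy : canonicalDist f P' y' y ≤ ε)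
    (hδ' : canonicalDist f P' x' y' ≤ δ) (hδ : canonicalDist f P' x y ≤ δ) :
    (∃ v : ℝ≥0, (v : ℝ) ≤ (2 * ε) ^ 2 ∧
      HasLaw (fun ω => f x' ω - f y' ω - (f x ω - f y ω)) (gaussianReal 0 v) P') ∧
    (∃ w : ℝ≥0, (w : ℝ) ≤ (2 * δ) ^ 2 ∧
      HasLaw (fun ω => f x' ω - f y' ω + (f x ω - f y ω)) (gaussianReal 0 w) P') := by
  have hinc := isGaussianProcess_increments hf
  have hi : ∀ t, Integrable (f t) P' := fun t => (hf.hasGaussianLaw_eval t).integrable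
  have hsq := integrable_sq_increment hf
  have hi2 : ∀ a b, Integrable (fun ω => f a ω - f b ω) P' := fun a b => (hi a).sub (hi b)
  have hd : ∀ {a b : T} {η : ℝ}, canonicalDist f P' a b ≤ η →
      ∫ ω, (f a ω - f b ω) ^ 2 ∂P' ≤ η ^ 2 := by
    intro a b η h
    rw [← sq_canonicalDist]
    exact pow_le_pow_left₀ (canonicalDist_nonneg f P' a b) h 2
  have hU := hinc.hasGaussianLaw_fun_sub (s := (x', y')) (t := (x, y))
  have hV := hinc.hasGaussianLaw_fun_add (s := (x', y')) (t := (x, y))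
  refine ⟨hasLaw_gaussianReal_of_sq_le hU ?_ ?_, hasLaw_gaussianReal_of_sq_le hV ?_ ?_⟩
  · rw [integral_sub (hi2 _ _) (hi2 _ _), integral_sub (hi _) (hi _),
      integral_sub (hi _) (hi _)]
    simp [h0]
  -- Regrouped as `(f x' - f x) - (f y' - f y)`, so that the closeness `ε` of the paired points
  -- enters.
  · calc ∫ ω, (f x' ω - f y' ω - (f x ω - f y ω)) ^ 2 ∂P' ≤
          ∫ ω, (2 * (f x' ω - f x ω) ^ 2 + 2 * (f y' ω - f y ω) ^ 2) ∂P' := by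
          refine integral_mono hU.memLp_two.integrable_sq
            (((hsq _ _).const_mul _).add ((hsq _ _).const_mul _)) fun ω => ?_
          simp only
          nlinarith [sq_nonneg (f x' ω - f x ω + (f y' ω - f y ω))]
      _ ≤ _ := by
          rw [integral_add ((hsq _ _).const_mul _) ((hsq _ _).const_mul _), integral_const_mul,
            integral_const_mul]
          linarith [hd hx, hd hy]
  · rw [integral_add (hi2 _ _) (hi2 _ _), integral_sub (hi _) (hi _),
      integral_sub (hi _) (hi _)]
    simp [h0]
  · calc ∫ ω, (f x' ω - f y' ω + (f x ω - f y ω)) ^ 2 ∂P' ≤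
          ∫ ω, (2 * (f x' ω - f y' ω) ^ 2 + 2 * (f x ω - f y ω) ^ 2) ∂P' := by
          refine integral_mono hV.memLp_two.integrable_sq
            (((hsq _ _).const_mul _).add ((hsq _ _).const_mul _)) fun ω => ?_
          simp only
          nlinarith [sq_nonneg (f x' ω - f y' ω - (f x ω - f y ω))]
      _ ≤ _ := by
          rw [integral_add ((hsq _ _).const_mul _) ((hsq _ _).const_mul _), integral_const_mul,
            integral_const_mul]
          linarith [hd hδ', hd hδ]

/-- Cauchy–Schwarz by weighted AM–GM: the weights `r/(2s)` and `s/(2r)` make each half contribute `s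
r / 2`. -/
lemma abs_integral_mul_le_of_sq_le [IsProbabilityMeasure P'] {U V : Ω' → ℝ} {s r : ℝ}
    (hs : 0 < s) (hr : 0 < r) (hU : MemLp U 2 P') (hV : MemLp V 2 P')
    (hUs : ∫ ω, U ω ^ 2 ∂P' ≤ s ^ 2) (hVr : ∫ ω, V ω ^ 2 ∂P' ≤ r ^ 2) :
    |∫ ω, U ω * V ω ∂P'| ≤ s * r := by
  have hU2 := hU.integrable_sq
  have hV2 := hV.integrable_sq
  calc |∫ ω, U ω * V ω ∂P'| ≤ ∫ ω, |U ω * V ω| ∂P' := abs_integral_le_integral_abs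
    _ ≤ ∫ ω, (r / (2 * s) * U ω ^ 2 + s / (2 * r) * V ω ^ 2) ∂P' := by
        refine integral_mono (MemLp.integrable_mul hU hV).abs
          ((hU2.const_mul _).add (hV2.const_mul _)) fun ω => ?_
        have e : r / (2 * s) * U ω ^ 2 + s / (2 * r) * V ω ^ 2 =
            ((r * U ω) ^ 2 + (s * V ω) ^ 2) / (2 * s * r) := by field_simp
        simp only
        rw [e, le_div_iff₀ (by positivity)]
        have : 2 * |r * U ω * (s * V ω)| ≤ (r * U ω) ^ 2 + (s * V ω) ^ 2 := by
          rw [← sq_abs (r * U ω), ← sq_abs (s * V ω), abs_mul]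
          nlinarith [sq_nonneg (|r * U ω| - |s * V ω|)]
        have e2 : |r * U ω * (s * V ω)| = |U ω * V ω| * (s * r) := by
          rw [show r * U ω * (s * V ω) = U ω * V ω * (s * r) by ring, abs_mul,
            abs_of_pos (mul_pos hs hr)]
        linarith
    _ ≤ r / (2 * s) * s ^ 2 + s / (2 * r) * r ^ 2 := by
        rw [integral_add (hU2.const_mul _) (hV2.const_mul _), integral_const_mul,
          integral_const_mul]
        gcongr
    _ = s * r := by field_simp; ring

/-- The exponential moment of the deviation increments. -/
lemma lintegral_exp_deviation_increment_le [IsProbabilityMeasure P']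
    (hf : IsGaussianProcess f P') (h0 : ∀ t, ∫ ω, f t ω ∂P' = 0)
    {Ω : Type*} [MeasurableSpace Ω] {P : Measure Ω} [IsProbabilityMeasure P]
    {k : ℕ} (hk : 0 < k) {F : Fin k → T → Ω → ℝ} (hF : IsIndepCopies F P f P')
    {ε δ : ℝ} (hε : 0 < ε) (hδ0 : 0 < δ) {x' y' x y : T}
    (hx : canonicalDist f P' x' x ≤ ε) (hy : canonicalDist f P' y' y ≤ ε)
    (hδ' : canonicalDist f P' x' y' ≤ δ) (hδ : canonicalDist f P' x y ≤ δ) :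
    ∫⁻ ω, ENNReal.ofReal (Real.exp (√k / (32 * (ε * δ)) *
      |deviation F (canonicalDist f P') x' y' ω - deviation F (canonicalDist f P') x y ω|)) ∂P ≤
      ENNReal.ofReal (2 * Real.exp 8) := by
  obtain ⟨⟨v, hv, hU⟩, ⟨w, hw, hV⟩⟩ := exists_hasLaw_increments hf h0 hx hy hδ' hδ
  have hinc := isGaussianProcess_increments hf
  have hU2 := (hinc.hasGaussianLaw_fun_sub (s := (x', y')) (t := (x, y))).memLp_two
  have hV2 := (hinc.hasGaussianLaw_fun_add (s := (x', y')) (t := (x, y))).memLp_two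
  have hmom : ∀ {X : Ω' → ℝ} {u : ℝ≥0}, HasLaw X (gaussianReal 0 u) P' →
      ∫ ω, X ω ^ 2 ∂P' = u := by
    intro X u hX
    have h1 : Var[X; P'] = u := by
      rw [hX.variance_eq]
      exact variance_id_gaussianReal
    have h2 : ∫ ω, X ω ∂P' = 0 := by
      rw [hX.integral_eq]; exact integral_id_gaussianReal
    rw [← h1, variance_of_integral_eq_zero hX.aemeasurable h2]
  set c : ℝ := canonicalDist f P' x' y' ^ 2 - canonicalDist f P' x y ^ 2 with hc
  have hcint : ∫ ω, (f x' ω - f y' ω - (f x ω - f y ω)) * (f x' ω - f y' ω + (f x ω - f y ω)) ∂P'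
      = c := by
    rw [hc, sq_canonicalDist, sq_canonicalDist,
      ← integral_sub (integrable_sq_increment hf _ _) (integrable_sq_increment hf _ _)]
    congr 1
    ext ω
    ring
  have hUV : Integrable (fun ω => (f x' ω - f y' ω - (f x ω - f y ω)) *
      (f x' ω - f y' ω + (f x ω - f y ω))) P' := MemLp.integrable_mul hU2 hV2
  have hcle : |c| ≤ 2 * ε * (2 * δ) := by
    rw [← hcint]
    exact abs_integral_mul_le_of_sq_le (by positivity) (by positivity) hU2 hV2
      ((hmom hU).trans_le hv) ((hmom hV).trans_le hw)
  obtain ⟨hI, hB⟩ := integral_exp_abs_centered_mul_le (by positivity) (by positivity) hU hV hv hw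
    hcle
  -- The normalized increment as a measurable functional of a whole path, so that both the common
  -- law and the independence of the copies pass to it.
  set φ : (T → ℝ) → ℝ := fun p =>
    ((p x' - p y' - (p x - p y)) * (p x' - p y' + (p x - p y)) - c) / (2 * ε * (2 * δ)) with hφ
  have hφm : Measurable φ := by rw [hφ]; fun_prop
  have hid : ∀ i, IdentDistrib (fun ω => φ (fun t => F i t ω)) (fun ω => φ (fun t => f t ω)) P P' :=
    fun i => (hF.identDistrib i).comp hφm
  have hide : ∀ i, IdentDistrib (fun ω => Real.exp (|φ (fun t => F i t ω)| / 4))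
      (fun ω => Real.exp (|φ (fun t => f t ω)| / 4)) P P' := fun i =>
    (hid i).comp (u := fun z => Real.exp (|z| / 4)) (by fun_prop)
  have hmain := lintegral_exp_abs_average_le hk (P := P) (B := 4)
    (Y := fun i ω => φ (fun t => F i t ω)) (hF.indep.comp (fun _ => φ) fun _ => hφm)
    (fun i => (hid i).aemeasurable_fst) (fun i => (hide i).integrable_iff.2 hI)
    (fun i => (hide i).integral_eq.trans_le hB) (fun i => by
      refine (hid i).integral_eq.trans ?_
      rw [hφ]
      simp only
      rw [integral_div, integral_sub hUV (integrable_const _)]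
      simp [hcint])
  refine le_trans (le_of_eq ?_) (hmain.trans (by norm_num))
  refine lintegral_congr fun ω => ?_
  congr 2
  -- The normalization `4εδ` turns the rate `√k/8` for averages into `√k/(32εδ)`.
  have hsum : deviation F (canonicalDist f P') x' y' ω - deviation F (canonicalDist f P') x y ω =
      4 * (ε * δ) * ((1 / k : ℝ) * ∑ i, φ (fun t => F i t ω)) := by
    rw [deviation_eq_average hk, deviation_eq_average hk, ← mul_sub, ← Finset.sum_sub_distrib,
      mul_left_comm, Finset.mul_sum (a := 4 * (ε * δ))]
    congr 1
    refine Finset.sum_congr rfl fun i _ => ?_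
    rw [hφ, hc]
    field_simp
    ring
  rw [hsum, abs_mul, abs_of_pos (by positivity : 0 < 4 * (ε * δ))]
  field_simp
  ring

lemma aemeasurable_deviation {Ω : Type*} [MeasurableSpace Ω] {P : Measure Ω} {k : ℕ}
    (hk : 0 < k) {F : Fin k → T → Ω → ℝ} (hF : IsIndepCopies F P f P') (D : T → T → ℝ) (x y : T) :
    AEMeasurable (deviation F D x y) P := by
  have hm : ∀ i t, AEMeasurable (F i t) P := fun i t =>
    (measurable_pi_apply t).comp_aemeasurable (hF.identDistrib i).aemeasurable_fst
  have : deviation F D x y = fun ω =>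
      (1 / k : ℝ) * ∑ i, ((F i x ω - F i y ω) ^ 2 - D x y ^ 2) :=
    funext fun ω => deviation_eq_average hk F D x y ω
  rw [this]
  refine AEMeasurable.const_mul (Finset.aemeasurable_fun_sum _ fun i _ => ?_) _
  exact (((hm i x).sub (hm i y)).pow_const 2).sub_const _

/-- A constant for the maximal inequality for deviation increments. -/
noncomputable def maximalConst : ℝ := 32 * (1 + 4 * Real.exp 8)

lemma maximalConst_pos : 0 < maximalConst := by unfold maximalConst; positivity

/-- The expected maximum of finitely many deviation increments. -/
lemma lintegral_iSup_deviation_increment_le [IsProbabilityMeasure P']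
    (hf : IsGaussianProcess f P') (h0 : ∀ t, ∫ ω, f t ω ∂P' = 0)
    {Ω : Type*} [MeasurableSpace Ω] {P : Measure Ω} [IsProbabilityMeasure P]
    {k : ℕ} (hk : 0 < k) {F : Fin k → T → Ω → ℝ} (hF : IsIndepCopies F P f P')
    {ε δ : ℝ} (hε : 0 ≤ ε) (hδ0 : 0 ≤ δ) (Q : Finset ((T × T) × (T × T)))
    (hQ : ∀ q ∈ Q, canonicalDist f P' q.1.1 q.2.1 ≤ ε ∧ canonicalDist f P' q.1.2 q.2.2 ≤ ε)
    (hδ : ∀ x y, canonicalDist f P' x y ≤ δ) :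
    ∫⁻ ω, ⨆ q ∈ Q, ENNReal.ofReal |deviation F (canonicalDist f P') q.1.1 q.1.2 ω -
        deviation F (canonicalDist f P') q.2.1 q.2.2 ω| ∂P ≤
      ENNReal.ofReal (maximalConst * (ε * δ / √k) * Real.log (Q.card + 1)) := by
  have hk' : 0 < √(k : ℝ) := Real.sqrt_pos.2 (by exact_mod_cast hk)
  -- The moment bound needs positive scales; enlarging both by `η` and letting `η → 0` covers `ε =
  -- 0` and `δ = 0`.
  have hpos : ∀ η : ℝ, 0 < η → ∫⁻ ω, ⨆ q ∈ Q, ENNReal.ofReal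
      |deviation F (canonicalDist f P') q.1.1 q.1.2 ω -
        deviation F (canonicalDist f P') q.2.1 q.2.2 ω| ∂P ≤
      ENNReal.ofReal (maximalConst * ((ε + η) * (δ + η) / √k) * Real.log (Q.card + 1)) := by
    intro η hη
    refine (lintegral_iSup_abs_le Q (lam := √k / (32 * ((ε + η) * (δ + η)))) (K := 2 * Real.exp 8)
      (by positivity) (by positivity) (fun q _ =>
        (aemeasurable_deviation hk hF _ _ _).sub (aemeasurable_deviation hk hF _ _ _))
      (fun q hq => lintegral_exp_deviation_increment_le hf h0 hk hF (by positivity)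
        (by positivity) ((hQ q hq).1.trans (by linarith)) ((hQ q hq).2.trans (by linarith))
        ((hδ _ _).trans (by linarith)) ((hδ _ _).trans (by linarith)))).trans (le_of_eq ?_)
    congr 1
    unfold maximalConst
    field_simp
    ring
  have hcont : Continuous fun η : ℝ =>
      ENNReal.ofReal (maximalConst * ((ε + η) * (δ + η) / √k) * Real.log (Q.card + 1)) :=
    ENNReal.continuous_ofReal.comp (by fun_prop)
  have hlim := (hcont.tendsto 0).mono_left (nhdsWithin_le_nhds (s := Set.Ioi 0))
  simp only [add_zero] at hlim
  exact ge_of_tendsto hlim (Filter.eventually_of_mem self_mem_nhdsWithin hpos)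

end Increments

/-! ### Covering numbers and the dyadic entropy sum -/

section Entropy

variable {T : Type*} {d : T → T → ℝ}

lemma coveringNumber_le_encard {ε : ℝ} {A : Set T} (hA : ∀ x, ∃ y ∈ A, d x y ≤ ε) :
    coveringNumber d ε ≤ A.encard :=
  iInf₂_le A hA

lemma coveringNumber_anti {ε ε' : ℝ} (h : ε ≤ ε') : coveringNumber d ε' ≤ coveringNumber d ε :=
  le_iInf₂ fun _ hA => coveringNumber_le_encard fun x =>
    let ⟨y, hy, hxy⟩ := hA x
    ⟨y, hy, hxy.trans h⟩

/-- An infimum over a nonempty family in `ℕ∞` is attained; over an empty family it would be `⊤`. -/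
lemma exists_finset_card_eq_coveringNumber {ε : ℝ} (h : coveringNumber d ε < ⊤) :
    ∃ A : Finset T, A.card = (coveringNumber d ε).toNat ∧ ∀ x, ∃ y ∈ A, d x y ≤ ε := by
  have hne : Nonempty {A : Set T // ∀ x, ∃ y ∈ A, d x y ≤ ε} := by
    by_contra hcon
    rw [not_nonempty_iff] at hcon
    rw [coveringNumber, iInf_subtype', iInf_of_empty] at h
    exact lt_irrefl _ h
  obtain ⟨⟨A, hA⟩, hmin⟩ := ciInf_mem
    (fun A : {A : Set T // ∀ x, ∃ y ∈ A, d x y ≤ ε} => A.1.encard)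
  have hAe : A.encard = coveringNumber d ε := by
    rw [coveringNumber, iInf_subtype']
    exact hmin
  have hfin : A.Finite := Set.encard_lt_top_iff.1 (hAe ▸ h)
  refine ⟨hfin.toFinset, ?_, fun x => ?_⟩
  · rw [← hAe, hfin.encard_eq_coe_toFinset_card, ENat.toNat_natCast]
  · simpa using hA x

lemma logEntropy_nonneg (ε : ℝ) : 0 ≤ logEntropy d ε :=
  Real.log_nonneg (by linarith [Nat.cast_nonneg (α := ℝ) (coveringNumber d ε).toNat])

/-- Finiteness at the smaller radius matters because `toNat` sends `⊤` to `0`. -/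
lemma logEntropy_anti {ε ε' : ℝ} (hε : coveringNumber d ε < ⊤) (h : ε ≤ ε') :
    logEntropy d ε' ≤ logEntropy d ε := by
  unfold logEntropy
  have : (coveringNumber d ε').toNat ≤ (coveringNumber d ε).toNat :=
    ENat.toNat_le_toNat (coveringNumber_anti h) hε.ne
  gcongr

/-- Comparison of the dyadic entropy sum with the entropy integral. -/
lemma sum_dyadic_logEntropy_le {Δ : ℝ} (hΔ : 0 < Δ)
    (hN : ∀ ε : ℝ, 0 < ε → coveringNumber d ε < ⊤)
    (hint : IntervalIntegrable (logEntropy d) volume 0 Δ) (J : ℕ) :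
    ∑ j ∈ Finset.range J, Δ / 2 ^ j * logEntropy d (Δ / 2 ^ (j + 1)) ≤
      4 * ∫ ε in (0 : ℝ)..Δ, logEntropy d ε := by
  have hpos : ∀ j : ℕ, 0 < Δ / 2 ^ j := fun j => by positivity
  have hle : ∀ j : ℕ, Δ / 2 ^ j ≤ Δ := fun j => div_le_self hΔ.le (one_le_pow₀ (by norm_num))
  have hsub : ∀ {a b : ℝ}, 0 ≤ a → a ≤ b → b ≤ Δ → IntervalIntegrable (logEntropy d) volume a b :=
    fun ha hab hb => hint.mono_set (by
      rw [Set.uIcc_of_le hab, Set.uIcc_of_le hΔ.le]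
      exact Set.Icc_subset_Icc ha hb)
  have hstep : ∀ j : ℕ, Δ / 2 ^ (j + 1) ≤ Δ / 2 ^ j := fun j => by
    rw [pow_succ, ← div_div]
    linarith [hpos j]
  -- The interval below `Δ/2^(j+1)` has length `Δ/2^j/4`, and there the entropy is at least its
  -- value at the right end. These intervals abut, so the integrals telescope.
  have hterm : ∀ j : ℕ, Δ / 2 ^ j * logEntropy d (Δ / 2 ^ (j + 1)) ≤
      4 * ∫ ε in (Δ / 2 ^ (j + 2))..(Δ / 2 ^ (j + 1)), logEntropy d ε := by
    intro j
    have h1 : ∫ _ε in (Δ / 2 ^ (j + 2))..(Δ / 2 ^ (j + 1)), logEntropy d (Δ / 2 ^ (j + 1)) ≤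
        ∫ ε in (Δ / 2 ^ (j + 2))..(Δ / 2 ^ (j + 1)), logEntropy d ε := by
      refine intervalIntegral.integral_mono_on (hstep (j + 1)) intervalIntegrable_const
        (hsub (hpos _).le (hstep _) (hle _)) fun ε hε => ?_
      exact logEntropy_anti (hN ε ((hpos _).trans_le hε.1)) hε.2
    rw [intervalIntegral.integral_const, smul_eq_mul] at h1
    have e : Δ / 2 ^ (j + 1) - Δ / 2 ^ (j + 2) = Δ / 2 ^ j / 4 := by
      field_simp
      ring
    rw [e] at h1
    linarith
  refine (Finset.sum_le_sum fun j _ => hterm j).trans ?_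
  rw [← Finset.mul_sum]
  have htel : ∀ J : ℕ, ∑ j ∈ Finset.range J,
      ∫ ε in (Δ / 2 ^ (j + 2))..(Δ / 2 ^ (j + 1)), logEntropy d ε =
      ∫ ε in (Δ / 2 ^ (J + 1))..(Δ / 2 ^ 1), logEntropy d ε := by
    intro J
    induction J with
    | zero => simp
    | succ J ih =>
      rw [Finset.sum_range_succ, ih, add_comm, intervalIntegral.integral_add_adjacent_intervals]
      · exact hsub (hpos _).le (hstep _) (hle _)
      · refine hsub (hpos _).le ?_ (hle _)
        exact div_le_div_of_nonneg_left hΔ.le (by positivity)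
          (pow_le_pow_right₀ (by norm_num) (by omega))
  rw [htel]
  refine mul_le_mul_of_nonneg_left ?_ (by norm_num)
  refine intervalIntegral.integral_mono_interval (hpos _).le ?_ (hle _)
    (ae_of_all _ fun ε => logEntropy_nonneg ε) hint
  exact div_le_div_of_nonneg_left hΔ.le (by positivity)
    (pow_le_pow_right₀ (by norm_num) (by omega))

end Entropy

/-! ### Chaining -/

section Chaining

variable {T Ω' : Type*} [MeasurableSpace Ω'] {P' : Measure Ω'} {f : T → Ω' → ℝ}

/-- With both legs bounded by the same `η`, `(u + v)² ≤ 2u² + 2v²` replaces the `L²` triangle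
inequality. -/
lemma canonicalDist_le_two_mul (hf : IsGaussianProcess f P') {η : ℝ} {x y z : T}
    (hxy : canonicalDist f P' x y ≤ η) (hyz : canonicalDist f P' y z ≤ η) :
    canonicalDist f P' x z ≤ 2 * η := by
  have hη : 0 ≤ η := (canonicalDist_nonneg f P' x y).trans hxy
  have hsq := integrable_sq_increment hf
  refine abs_le_of_sq_le_sq' ?_ (by positivity) |>.2
  have h1 := pow_le_pow_left₀ (canonicalDist_nonneg f P' x y) hxy 2
  have h2 := pow_le_pow_left₀ (canonicalDist_nonneg f P' y z) hyz 2
  have h3 : canonicalDist f P' x z ^ 2 ≤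
      2 * canonicalDist f P' x y ^ 2 + 2 * canonicalDist f P' y z ^ 2 := by
    rw [sq_canonicalDist, sq_canonicalDist, sq_canonicalDist, ← integral_const_mul,
      ← integral_const_mul, ← integral_add ((hsq _ _).const_mul _) ((hsq _ _).const_mul _)]
    refine integral_mono (hsq _ _) (((hsq _ _).const_mul _).add ((hsq _ _).const_mul _))
      fun ω => ?_
    simp only
    nlinarith [sq_nonneg (f x ω - f y ω - (f y ω - f z ω))]
  nlinarith

lemma canonicalDist_le_diam (hbdd : BddAbove (Set.range fun p : T × T =>
    canonicalDist f P' p.1 p.2)) (x y : T) :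
    canonicalDist f P' x y ≤ diam (canonicalDist f P') :=
  le_ciSup hbdd (x, y)

lemma deviation_self {Ω : Type*} {k : ℕ} (F : Fin k → T → Ω → ℝ) (x : T) (ω : Ω) :
    deviation F (canonicalDist f P') x x ω = 0 := by
  simp [deviation, canonicalDist_self]

lemma log_pow_four_add_one_le (m : ℕ) :
    Real.log ((m : ℝ) ^ 4 + 1) ≤ 4 * Real.log (m + 1) := by
  have hm : (0 : ℝ) ≤ m := Nat.cast_nonneg m
  have h : Real.log ((m + 1 : ℝ) ^ 4) = 4 * Real.log (m + 1) := by
    rw [Real.log_pow]; norm_num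
  rw [← h]
  refine Real.log_le_log (by positivity) ?_
  nlinarith [pow_nonneg hm 2, pow_nonneg hm 3]

/-- Successive nets along the dyadic scales, the first one being a single point. -/
lemma exists_dyadic_nets (hbdd : BddAbove (Set.range fun p : T × T =>
    canonicalDist f P' p.1 p.2)) (hΔ : 0 < diam (canonicalDist f P'))
    (hN : ∀ ε : ℝ, 0 < ε → coveringNumber (canonicalDist f P') ε < ⊤) (x₀ : T) :
    ∃ (A : ℕ → Finset T) (π : ℕ → T → T), (∀ x, π 0 x = x₀) ∧ (∀ j x, π j x ∈ A j) ∧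
      (∀ j x, canonicalDist f P' x (π j x) ≤ diam (canonicalDist f P') / 2 ^ j) ∧
      (∀ j, (A (j + 1)).card = (coveringNumber (canonicalDist f P')
        (diam (canonicalDist f P') / 2 ^ (j + 1))).toNat) ∧
      ∀ j, (A j).card ≤ (A (j + 1)).card := by
  set D := canonicalDist f P'
  have hpos : ∀ j : ℕ, 0 < diam D / 2 ^ j := fun j => by positivity
  choose B hBc hB using fun j : ℕ => exists_finset_card_eq_coveringNumber (hN _ (hpos j))
  choose ρ hρB hρ using hB
  -- At scale `Δ` any single point is a net, so level `0` can be the prescribed `x₀`.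
  refine ⟨fun j => if j = 0 then {x₀} else B j, fun j => if j = 0 then fun _ => x₀ else ρ j,
    fun x => by simp, fun j x => ?_, fun j x => ?_, fun j => by simp [hBc], fun j => ?_⟩
  · by_cases hj : j = 0
    · simp [hj]
    · simpa [hj] using hρB j x
  · by_cases hj : j = 0
    · simpa [hj] using canonicalDist_le_diam hbdd x x₀
    · simpa [hj] using hρ j x
  · by_cases hj : j = 0
    · simp only [hj, ↓reduceIte, Finset.card_singleton]
      exact Finset.card_pos.2 ⟨_, hρB (0 + 1) x₀⟩
    · simp only [hj, ↓reduceIte, Nat.add_eq_zero_iff, one_ne_zero, and_false, hBc]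
      refine ENat.toNat_le_toNat (coveringNumber_anti ?_) (hN _ (hpos _)).ne
      rw [pow_succ, ← div_div]
      linarith [hpos j]

variable [IsProbabilityMeasure P'] {Ω : Type*} [MeasurableSpace Ω] {P : Measure Ω}
  [IsProbabilityMeasure P]

open Classical in
/-- The maximal inequality for the increments of the deviation along two maps. -/
lemma lintegral_iSup_deviation_link_le (hf : IsGaussianProcess f P')
    (h0 : ∀ t, ∫ ω, f t ω ∂P' = 0) {k : ℕ} (hk : 0 < k) {F : Fin k → T → Ω → ℝ}
    (hF : IsIndepCopies F P f P')
    (hbdd : BddAbove (Set.range fun p : T × T => canonicalDist f P' p.1 p.2)) {ε : ℝ} (hε : 0 ≤ ε)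
    (S A' A : Finset T) (π' π : T → T) (hA' : ∀ x ∈ S, π' x ∈ A') (hA : ∀ x ∈ S, π x ∈ A)
    (hπ : ∀ x ∈ S, canonicalDist f P' (π' x) (π x) ≤ ε) :
    ∫⁻ ω, ⨆ (x ∈ S) (y ∈ S), ENNReal.ofReal |deviation F (canonicalDist f P') (π' x) (π' y) ω -
        deviation F (canonicalDist f P') (π x) (π y) ω| ∂P ≤
      ENNReal.ofReal (maximalConst * (ε * diam (canonicalDist f P') / √k) *
        Real.log ((A'.card : ℝ) ^ 2 * (A.card : ℝ) ^ 2 + 1)) := by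
  rcases S.eq_empty_or_nonempty with rfl | ⟨x₀, hx₀⟩
  · simp
  have hΔ : 0 ≤ diam (canonicalDist f P') :=
    (canonicalDist_nonneg f P' x₀ x₀).trans (canonicalDist_le_diam hbdd _ _)
  -- Only distinct links count: the image of `S ×ˢ S` is bounded by the nets, whatever the size of
  -- `S`.
  set Q : Finset ((T × T) × (T × T)) :=
    (S ×ˢ S).image fun p => ((π' p.1, π' p.2), (π p.1, π p.2)) with hQ
  have hcard : Q.card ≤ A'.card ^ 2 * A.card ^ 2 := by
    have : Q ⊆ (A' ×ˢ A') ×ˢ (A ×ˢ A) := by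
      intro q hq
      rw [hQ, Finset.mem_image] at hq
      obtain ⟨p, hp, rfl⟩ := hq
      rw [Finset.mem_product] at hp
      simp [hA' _ hp.1, hA' _ hp.2, hA _ hp.1, hA _ hp.2]
    refine (Finset.card_le_card this).trans (le_of_eq ?_)
    simp only [Finset.card_product]
    ring
  have hmain := lintegral_iSup_deviation_increment_le hf h0 hk hF hε hΔ Q (by
    intro q hq
    rw [hQ, Finset.mem_image] at hq
    obtain ⟨p, hp, rfl⟩ := hq
    rw [Finset.mem_product] at hp
    exact ⟨hπ _ hp.1, hπ _ hp.2⟩) (canonicalDist_le_diam hbdd)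
  refine (lintegral_mono fun ω => ?_).trans (hmain.trans (ENNReal.ofReal_le_ofReal ?_))
  · refine iSup₂_le fun x hx => iSup₂_le fun y hy => ?_
    exact le_iSup₂_of_le ((π' x, π' y), (π x, π y))
      (Finset.mem_image.2 ⟨(x, y), Finset.mem_product.2 ⟨hx, hy⟩, rfl⟩) le_rfl
  · have := maximalConst_pos
    refine mul_le_mul_of_nonneg_left ?_ (by positivity)
    refine Real.log_le_log (by positivity) ?_
    have : (Q.card : ℝ) ≤ (A'.card : ℝ) ^ 2 * (A.card : ℝ) ^ 2 := by exact_mod_cast hcard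
    linarith

omit [IsProbabilityMeasure P'] [IsProbabilityMeasure P] in
lemma aemeasurable_iSup_deviation_link {k : ℕ} (hk : 0 < k) {F : Fin k → T → Ω → ℝ}
    (hF : IsIndepCopies F P f P') (S : Finset T) (π' π : T → T) :
    AEMeasurable (fun ω => ⨆ (x ∈ S) (y ∈ S),
      ENNReal.ofReal |deviation F (canonicalDist f P') (π' x) (π' y) ω -
        deviation F (canonicalDist f P') (π x) (π y) ω|) P := by
  refine AEMeasurable.biSup (S : Set T) S.countable_toSet fun x _ =>
    AEMeasurable.biSup (S : Set T) S.countable_toSet fun y _ => ?_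
  exact (continuous_abs.measurable.comp_aemeasurable ((aemeasurable_deviation hk hF _ _ _).sub
    (aemeasurable_deviation hk hF _ _ _))).ennreal_ofReal

omit [IsProbabilityMeasure P'] [MeasurableSpace Ω] in
/-- Telescoping of the deviation along a chain that starts at a single point. -/
lemma supDeviation_le_sum_links {k : ℕ} (F : Fin k → T → Ω → ℝ) (S : Finset T) {x₀ : T}
    {π : ℕ → T → T} (hπ0 : ∀ x, π 0 x = x₀) (J : ℕ) (ω : Ω) :
    supDeviation F (canonicalDist f P') S ω ≤
      ∑ j ∈ Finset.range J, (⨆ (x ∈ S) (y ∈ S),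
        ENNReal.ofReal |deviation F (canonicalDist f P') (π (j + 1) x) (π (j + 1) y) ω -
          deviation F (canonicalDist f P') (π j x) (π j y) ω|) +
      ⨆ (x ∈ S) (y ∈ S), ENNReal.ofReal |deviation F (canonicalDist f P') x y ω -
          deviation F (canonicalDist f P') (π J x) (π J y) ω| := by
  refine iSup₂_le fun x hx => iSup₂_le fun y hy => ?_
  change ENNReal.ofReal |deviation F (canonicalDist f P') x y ω| ≤ _
  set Z : ℕ → ℝ := fun j => deviation F (canonicalDist f P') (π j x) (π j y) ω with hZ
  have hZ0 : Z 0 = 0 := by simp [hZ, hπ0, deviation_self]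
  have htel : deviation F (canonicalDist f P') x y ω =
      ∑ j ∈ Finset.range J, (Z (j + 1) - Z j) + (deviation F (canonicalDist f P') x y ω - Z J) := by
    rw [Finset.sum_range_sub, hZ0]
    ring
  have habs : |deviation F (canonicalDist f P') x y ω| ≤
      ∑ j ∈ Finset.range J, |Z (j + 1) - Z j| + |deviation F (canonicalDist f P') x y ω - Z J| := by
    conv_lhs => rw [htel]
    exact (abs_add_le _ _).trans (add_le_add (Finset.abs_sum_le_sum_abs _ _) le_rfl)
  refine (ENNReal.ofReal_le_ofReal habs).trans ?_
  rw [ENNReal.ofReal_add (Finset.sum_nonneg fun _ _ => abs_nonneg _) (abs_nonneg _),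
    ENNReal.ofReal_sum_of_nonneg fun _ _ => abs_nonneg _]
  refine add_le_add (Finset.sum_le_sum fun j _ => ?_) ?_
  · exact le_iSup₂_of_le x hx (le_iSup₂_of_le y hy le_rfl)
  · exact le_iSup₂_of_le x hx (le_iSup₂_of_le y hy le_rfl)

/-- The chaining bound over a finite set of parameters, at a finite number of scales. -/
lemma lintegral_supDeviation_finset_le_add (hf : IsGaussianProcess f P')
    (h0 : ∀ t, ∫ ω, f t ω ∂P' = 0) {k : ℕ} (hk : 0 < k) {F : Fin k → T → Ω → ℝ}
    (hF : IsIndepCopies F P f P')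
    (hbdd : BddAbove (Set.range fun p : T × T => canonicalDist f P' p.1 p.2))
    (hΔ : 0 < diam (canonicalDist f P'))
    (hN : ∀ ε : ℝ, 0 < ε → coveringNumber (canonicalDist f P') ε < ⊤)
    (hint : IntervalIntegrable (logEntropy (canonicalDist f P')) volume 0
      (diam (canonicalDist f P')))
    (S : Finset T) (J : ℕ) :
    ∫⁻ ω, supDeviation F (canonicalDist f P') S ω ∂P ≤
      ENNReal.ofReal (32 * maximalConst * entropyBound (canonicalDist f P') k) +
      ENNReal.ofReal (maximalConst * (diam (canonicalDist f P') / 2 ^ J *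
        diam (canonicalDist f P') / √k) *
        Real.log ((S.card : ℝ) ^ 2 * (S.card : ℝ) ^ 2 + 1)) := by
  classical
  rcases S.eq_empty_or_nonempty with rfl | ⟨x₀, -⟩
  · simp [supDeviation]
  have hC := maximalConst_pos
  obtain ⟨A, π, hπ0, hπA, hπ, hAN, hAmono⟩ := exists_dyadic_nets hbdd hΔ hN x₀
  set D := canonicalDist f P' with hD
  set Δ := diam D with hΔd
  have hlevel : ∀ j : ℕ, ∫⁻ ω, ⨆ (x ∈ S) (y ∈ S),
      ENNReal.ofReal |deviation F D (π (j + 1) x) (π (j + 1) y) ω -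
          deviation F D (π j x) (π j y) ω| ∂P ≤
      ENNReal.ofReal (8 * maximalConst * (Δ / √k) *
        (Δ / 2 ^ j * logEntropy D (Δ / 2 ^ (j + 1)))) := by
    intro j
    -- This factor `2`, and the `4` from the fourth power of the net size, give the `8` above.
    have hdist : ∀ x, D (π (j + 1) x) (π j x) ≤ 2 * (Δ / 2 ^ j) := by
      intro x
      refine canonicalDist_le_two_mul hf (y := x) ?_ (hπ j x)
      rw [canonicalDist_comm]
      refine (hπ (j + 1) x).trans ?_
      exact div_le_div_of_nonneg_left hΔ.le (by positivity)
        (pow_le_pow_right₀ (by norm_num) (by omega))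
    refine (lintegral_iSup_deviation_link_le hf h0 hk hF hbdd (by positivity) S (A (j + 1)) (A j)
      (π (j + 1)) (π j) (fun x _ => hπA _ x) (fun x _ => hπA _ x) (fun x _ => hdist x)).trans
      (ENNReal.ofReal_le_ofReal ?_)
    have hlog : Real.log (((A (j + 1)).card : ℝ) ^ 2 * ((A j).card : ℝ) ^ 2 + 1) ≤
        4 * logEntropy D (Δ / 2 ^ (j + 1)) := by
      rw [logEntropy, ← hAN j]
      refine le_trans (Real.log_le_log (by positivity) ?_) (log_pow_four_add_one_le _)
      have : ((A j).card : ℝ) ≤ (A (j + 1)).card := by exact_mod_cast hAmono j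
      calc ((A (j + 1)).card : ℝ) ^ 2 * ((A j).card : ℝ) ^ 2 + 1 ≤
            ((A (j + 1)).card : ℝ) ^ 2 * ((A (j + 1)).card : ℝ) ^ 2 + 1 := by gcongr
        _ = _ := by ring
    calc _ ≤ maximalConst * (2 * (Δ / 2 ^ j) * Δ / √k) *
          (4 * logEntropy D (Δ / 2 ^ (j + 1))) := mul_le_mul_of_nonneg_left hlog (by positivity)
      _ = _ := by ring
  -- The last link goes from the net to `S` itself. Its logarithm depends on `S.card`, not on
  -- entropy, but the factor `Δ/2^J` removes it in the limit.
  have hlast := lintegral_iSup_deviation_link_le hf h0 hk hF hbdd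
    (ε := Δ / 2 ^ J) (by positivity) S S (S.image (π J)) id (π J) (fun x hx => hx)
    (fun x hx => Finset.mem_image_of_mem _ hx) (fun x _ => hπ J x)
  have hlast' : ∫⁻ ω, ⨆ (x ∈ S) (y ∈ S),
      ENNReal.ofReal |deviation F D x y ω - deviation F D (π J x) (π J y) ω| ∂P ≤
      ENNReal.ofReal (maximalConst * (Δ / 2 ^ J * Δ / √k) *
        Real.log ((S.card : ℝ) ^ 2 * (S.card : ℝ) ^ 2 + 1)) := by
    refine hlast.trans (ENNReal.ofReal_le_ofReal ?_)
    have : ((S.image (π J)).card : ℝ) ≤ S.card := by exact_mod_cast Finset.card_image_le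
    gcongr
  refine (lintegral_mono (supDeviation_le_sum_links F S hπ0 J)).trans ?_
  rw [lintegral_add_left' (Finset.aemeasurable_fun_sum _ fun j _ =>
      aemeasurable_iSup_deviation_link hk hF S (π (j + 1)) (π j)),
    lintegral_finsetSum' _ fun j _ => aemeasurable_iSup_deviation_link hk hF S (π (j + 1)) (π j)]
  refine add_le_add ((Finset.sum_le_sum fun j _ => hlevel j).trans ?_) hlast'
  rw [← ENNReal.ofReal_sum_of_nonneg fun j _ => mul_nonneg (by positivity)
    (mul_nonneg (by positivity) (logEntropy_nonneg _)), ← Finset.mul_sum]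
  refine ENNReal.ofReal_le_ofReal ?_
  calc _ ≤ 8 * maximalConst * (Δ / √k) * (4 * ∫ ε in (0 : ℝ)..Δ, logEntropy D ε) :=
        mul_le_mul_of_nonneg_left (sum_dyadic_logEntropy_le hΔ hN hint J) (by positivity)
    _ = _ := by rw [entropyBound]; ring

/-- The chaining bound over a finite set of parameters. -/
lemma lintegral_supDeviation_finset_le (hf : IsGaussianProcess f P')
    (h0 : ∀ t, ∫ ω, f t ω ∂P' = 0) {k : ℕ} (hk : 0 < k) {F : Fin k → T → Ω → ℝ}
    (hF : IsIndepCopies F P f P')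
    (hbdd : BddAbove (Set.range fun p : T × T => canonicalDist f P' p.1 p.2))
    (hN : ∀ ε : ℝ, 0 < ε → coveringNumber (canonicalDist f P') ε < ⊤)
    (hint : IntervalIntegrable (logEntropy (canonicalDist f P')) volume 0
      (diam (canonicalDist f P')))
    (S : Finset T) :
    ∫⁻ ω, supDeviation F (canonicalDist f P') S ω ∂P ≤
      ENNReal.ofReal (32 * maximalConst * entropyBound (canonicalDist f P') k) := by
  rcases S.eq_empty_or_nonempty with rfl | ⟨x₀, -⟩
  · simp [supDeviation]
  have hΔ0 : 0 ≤ diam (canonicalDist f P') :=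
    (canonicalDist_nonneg f P' x₀ x₀).trans (canonicalDist_le_diam hbdd _ _)
  rcases hΔ0.eq_or_lt with hΔ | hΔ
  -- For diameter `0` there are no dyadic scales; one link to a constant map at `ε = 0` already
  -- gives the bound `0`.
  · have h := lintegral_iSup_deviation_link_le hf h0 hk hF hbdd le_rfl S S {x₀} id (fun _ => x₀)
      (fun x hx => hx) (fun x _ => by simp)
      (fun x _ => (canonicalDist_le_diam hbdd x x₀).trans_eq hΔ.symm)
    simp only [id, deviation_self, sub_zero, zero_mul, zero_div, mul_zero,
      ENNReal.ofReal_zero] at h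
    exact h.trans zero_le
  · set D := canonicalDist f P'
    have hlim : Filter.Tendsto (fun J : ℕ => ENNReal.ofReal (32 * maximalConst * entropyBound D k) +
        ENNReal.ofReal (maximalConst * (diam D / 2 ^ J * diam D / √k) *
          Real.log ((S.card : ℝ) ^ 2 * (S.card : ℝ) ^ 2 + 1))) Filter.atTop
        (nhds (ENNReal.ofReal (32 * maximalConst * entropyBound D k) + ENNReal.ofReal 0)) := by
      refine tendsto_const_nhds.add (ENNReal.tendsto_ofReal ?_)
      have h1 : Filter.Tendsto (fun J : ℕ => diam D / 2 ^ J) Filter.atTop (nhds 0) :=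
        tendsto_const_nhds.div_atTop (tendsto_pow_atTop_atTop_of_one_lt (by norm_num))
      have h2 := (((h1.mul_const (diam D)).div_const (√(k : ℝ))).const_mul maximalConst).mul_const
        (Real.log ((S.card : ℝ) ^ 2 * (S.card : ℝ) ^ 2 + 1))
      simpa using h2
    rw [ENNReal.ofReal_zero, add_zero] at hlim
    exact ge_of_tendsto' hlim fun J =>
      lintegral_supDeviation_finset_le_add hf h0 hk hF hbdd hΔ hN hint S J

omit [IsProbabilityMeasure P'] [IsProbabilityMeasure P] in
lemma aemeasurable_supDeviation {k : ℕ} (hk : 0 < k) {F : Fin k → T → Ω → ℝ}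
    (hF : IsIndepCopies F P f P') (D : T → T → ℝ) {S : Set T} (hS : S.Countable) :
    AEMeasurable (supDeviation F D S) P := by
  refine AEMeasurable.biSup S hS fun x _ => AEMeasurable.biSup S hS fun y _ => ?_
  exact (continuous_abs.measurable.comp_aemeasurable
    (aemeasurable_deviation hk hF D x y)).ennreal_ofReal

/-- The chaining bound over a countable set of parameters. -/
lemma lintegral_supDeviation_countable_le (hf : IsGaussianProcess f P')
    (h0 : ∀ t, ∫ ω, f t ω ∂P' = 0) {k : ℕ} (hk : 0 < k) {F : Fin k → T → Ω → ℝ}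
    (hF : IsIndepCopies F P f P')
    (hbdd : BddAbove (Set.range fun p : T × T => canonicalDist f P' p.1 p.2))
    (hN : ∀ ε : ℝ, 0 < ε → coveringNumber (canonicalDist f P') ε < ⊤)
    (hint : IntervalIntegrable (logEntropy (canonicalDist f P')) volume 0
      (diam (canonicalDist f P')))
    {S : Set T} (hS : S.Countable) :
    ∫⁻ ω, supDeviation F (canonicalDist f P') S ω ∂P ≤
      ENNReal.ofReal (32 * maximalConst * entropyBound (canonicalDist f P') k) := by
  classical
  rcases S.eq_empty_or_nonempty with rfl | hne
  · simp [supDeviation]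
  obtain ⟨e, rfl⟩ := hS.exists_eq_range hne
  set D := canonicalDist f P'
  set G : ℕ → Finset T := fun n => (Finset.range (n + 1)).image e
  have hmem : ∀ {i n : ℕ}, i ≤ n → e i ∈ G n := fun h =>
    Finset.mem_image_of_mem _ (Finset.mem_range.2 (by omega))
  have hmono : ∀ {n m : ℕ}, n ≤ m → (G n : Set T) ⊆ G m := fun h =>
    Finset.coe_subset.2 (Finset.image_subset_image (Finset.range_subset_range.2 (by omega)))
  have hsup : ∀ ω, supDeviation F D (Set.range e) ω ≤ ⨆ n, supDeviation F D (G n) ω := by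
    intro ω
    refine iSup₂_le fun x hx => iSup₂_le fun y hy => ?_
    obtain ⟨i, rfl⟩ := hx
    obtain ⟨j, rfl⟩ := hy
    refine le_iSup_of_le (max i j) ?_
    exact le_iSup₂_of_le (e i) (hmem (le_max_left _ _))
      (le_iSup₂_of_le (e j) (hmem (le_max_right _ _)) le_rfl)
  calc _ ≤ ∫⁻ ω, ⨆ n, supDeviation F D (G n) ω ∂P := lintegral_mono hsup
    _ = ⨆ n, ∫⁻ ω, supDeviation F D (G n) ω ∂P := by
        refine lintegral_iSup' (fun n => aemeasurable_supDeviation hk hF D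
          (G n).countable_toSet) (ae_of_all _ fun ω n m hnm => ?_)
        exact iSup₂_le fun x hx => iSup₂_le fun y hy =>
          le_iSup₂_of_le x (hmono hnm hx) (le_iSup₂_of_le y (hmono hnm hy) le_rfl)
    _ ≤ _ := iSup_le fun n => lintegral_supDeviation_finset_le hf h0 hk hF hbdd hN hint (G n)

end Chaining

/-! ### Polynomial covering numbers and integrability of the entropy -/

section Covering

variable {n : ℕ} {T : Set (EuclideanSpace ℝ (Fin n))}

/-- A bounded subset of Euclidean space has nets, with centers in the set, of polynomial size. -/
lemma exists_euclidean_net {R θ : ℝ} (hR : ∀ x ∈ T, ‖x‖ ≤ R) (hθ : 0 < θ) :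
    ∃ A : Set T, A.encard ≤ ((2 * ⌈R / θ⌉₊ + 1) ^ n : ℕ) ∧
      ∀ x : T, ∃ y ∈ A, dist x y ≤ √n * θ := by
  classical
  set m : ℕ := ⌈R / θ⌉₊ with hm
  -- Index of the grid cell of side `θ` containing `x`. One point of `T` is chosen in each occupied
  -- cell, which keeps the centers in `T`.
  set g : T → Fin n → ℤ := fun x i => ⌊(x : EuclideanSpace ℝ (Fin n)) i / θ⌋ with hg
  have hmem : ∀ x, g x ∈ Fintype.piFinset fun _ : Fin n => Finset.Icc (-(m : ℤ)) m := by
    intro x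
    rw [Fintype.mem_piFinset]
    intro i
    have h1 : |(x : EuclideanSpace ℝ (Fin n)) i / θ| ≤ m := by
      rw [abs_div, abs_of_pos hθ]
      refine le_trans ?_ (Nat.le_ceil _)
      have := (PiLp.norm_apply_le (x : EuclideanSpace ℝ (Fin n)) i).trans (hR x x.2)
      rw [Real.norm_eq_abs] at this
      gcongr
    rw [abs_le] at h1
    rw [Finset.mem_Icc]
    constructor
    · rw [hg, Int.le_floor]
      push_cast
      exact h1.1
    · have : (⌊(x : EuclideanSpace ℝ (Fin n)) i / θ⌋ : ℝ) ≤ m := (Int.floor_le _).trans h1.2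
      exact_mod_cast this
  have hclose : ∀ x y : T, g x = g y → dist x y ≤ √n * θ := by
    intro x y hxy
    rw [Subtype.dist_eq, EuclideanSpace.dist_eq]
    refine Real.sqrt_le_iff.2 ⟨by positivity, ?_⟩
    rw [mul_pow, Real.sq_sqrt (Nat.cast_nonneg _)]
    calc _ ≤ ∑ _i : Fin n, θ ^ 2 := by
          refine Finset.sum_le_sum fun i _ => ?_
          refine pow_le_pow_left₀ dist_nonneg ?_ 2
          have h := Int.abs_sub_lt_one_of_floor_eq_floor (congrFun hxy i)
          rw [← sub_div, abs_div, abs_of_pos hθ, div_lt_one hθ] at h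
          rw [Real.dist_eq]
          exact h.le
      _ = _ := by simp
  refine ⟨Set.range fun z : Set.range g => z.2.choose, ?_, fun x => ?_⟩
  · calc _ ≤ (Set.range g).encard := by
          rw [← Set.image_univ]
          refine (Set.encard_image_le _ _).trans ?_
          rw [Set.encard_univ, Set.encard]
      _ ≤ ((Fintype.piFinset fun _ : Fin n => Finset.Icc (-(m : ℤ)) m :
            Finset (Fin n → ℤ)) : Set (Fin n → ℤ)).encard := by
          refine Set.encard_le_encard ?_
          rintro _ ⟨x, rfl⟩
          exact_mod_cast hmem x
      _ = _ := by
          rw [Set.encard_coe_eq_coe_finsetCard, Fintype.card_piFinset_const, Int.card_Icc]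
          congr 2
          omega
  · refine ⟨_, ⟨⟨g x, x, rfl⟩, rfl⟩, hclose _ _ ?_⟩
    exact (Exists.choose_spec (⟨x, rfl⟩ : g x ∈ Set.range g)).symm

/-- A grid of mesh about `ε²/(L√n)` is an `ε`-net for `D`; the `+ 1` in the denominator guards
against `L√n = 0`. -/
lemma coveringNumber_le_of_sq_le {D : T → T → ℝ} {R L ε : ℝ} (hL : 0 ≤ L)
    (hR : ∀ x ∈ T, ‖x‖ ≤ R) (hD : ∀ x y, D x y ^ 2 ≤ L * dist x y) (hε : 0 < ε) :
    coveringNumber D ε ≤ ((2 * ⌈R / (ε ^ 2 / (L * √n + 1))⌉₊ + 1) ^ n : ℕ) := by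
  obtain ⟨A, hA, hcov⟩ := exists_euclidean_net (θ := ε ^ 2 / (L * √n + 1)) hR (by positivity)
  refine (coveringNumber_le_encard fun x => ?_).trans hA
  obtain ⟨y, hy, hxy⟩ := hcov x
  refine ⟨y, hy, abs_le_of_sq_le_sq' ?_ hε.le |>.2⟩
  calc D x y ^ 2 ≤ L * (√n * (ε ^ 2 / (L * √n + 1))) :=
        (hD x y).trans (mul_le_mul_of_nonneg_left hxy hL)
    _ = L * √n / (L * √n + 1) * ε ^ 2 := by ring
    _ ≤ 1 * ε ^ 2 := by
        gcongr
        rw [div_le_one (by positivity)]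
        linarith
    _ = ε ^ 2 := one_mul _

/-- The entropy is dominated by a constant minus `2n log ε`, integrable at `0`; monotonicity
supplies measurability. -/
lemma intervalIntegrable_logEntropy {D : T → T → ℝ} {R L : ℝ} (hL : 0 ≤ L)
    (hR0 : 0 ≤ R) (hR : ∀ x ∈ T, ‖x‖ ≤ R) (hD : ∀ x y, D x y ^ 2 ≤ L * dist x y)
    {Δ : ℝ} (hΔ : 0 ≤ Δ) : IntervalIntegrable (logEntropy D) volume 0 Δ := by
  have hfin : ∀ ε, 0 < ε → coveringNumber D ε < ⊤ := fun ε hε =>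
    (coveringNumber_le_of_sq_le hL hR hD hε).trans_lt (ENat.natCast_lt_top _)
  set a : ℝ := 2 * R * (L * √n + 1) + 1 with ha
  have ha0 : 0 < a := by positivity
  have hbound : ∀ ε ∈ Set.Ioc 0 Δ, logEntropy D ε ≤
      Real.log 2 + n * (Real.log (a + 3 * Δ ^ 2) - 2 * Real.log ε) := by
    intro ε hε
    have hε0 := hε.1
    set m : ℕ := ⌈R / (ε ^ 2 / (L * √n + 1))⌉₊ with hm
    have hN : ((coveringNumber D ε).toNat : ℝ) ≤ (2 * m + 1 : ℝ) ^ n := by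
      have := ENat.toNat_le_toNat (coveringNumber_le_of_sq_le hL hR hD hε0) (ENat.natCast_ne_top _)
      rw [ENat.toNat_natCast] at this
      exact_mod_cast this
    have hm1 : (m : ℝ) ≤ R / (ε ^ 2 / (L * √n + 1)) + 1 :=
      (Nat.ceil_lt_add_one (by positivity)).le
    have hm2 : (2 * m + 1 : ℝ) ≤ (a + 3 * Δ ^ 2) / ε ^ 2 := by
      rw [le_div_iff₀ (by positivity)]
      have e : R / (ε ^ 2 / (L * √n + 1)) * ε ^ 2 = R * (L * √n + 1) := by field_simp
      have h1 : (m : ℝ) * ε ^ 2 ≤ R * (L * √n + 1) + ε ^ 2 := by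
        calc (m : ℝ) * ε ^ 2 ≤ (R / (ε ^ 2 / (L * √n + 1)) + 1) * ε ^ 2 := by gcongr
          _ = _ := by rw [add_mul, e, one_mul]
      have h2 : ε ^ 2 ≤ Δ ^ 2 := pow_le_pow_left₀ hε0.le hε.2 2
      rw [ha]
      linarith
    have hm0 : (1 : ℝ) ≤ 2 * m + 1 := by linarith [Nat.cast_nonneg (α := ℝ) m]
    calc logEntropy D ε ≤ Real.log (2 * (2 * m + 1 : ℝ) ^ n) := by
          refine Real.log_le_log (by positivity) ?_
          linarith [one_le_pow₀ hm0 (n := n)]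
      _ = Real.log 2 + n * Real.log (2 * m + 1) := by
          rw [Real.log_mul (by norm_num) (by positivity), Real.log_pow]
      _ ≤ Real.log 2 + n * Real.log ((a + 3 * Δ ^ 2) / ε ^ 2) := by gcongr
      _ = _ := by
          rw [Real.log_div (by positivity) (by positivity), Real.log_pow]
          norm_num
  have hg : IntervalIntegrable (fun ε =>
      Real.log 2 + n * (Real.log (a + 3 * Δ ^ 2) - 2 * Real.log ε)) volume 0 Δ :=
    intervalIntegrable_const.add ((intervalIntegrable_const.sub
      (intervalIntegral.intervalIntegrable_log'.const_mul 2)).const_mul _)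
  rw [intervalIntegrable_iff_integrableOn_Ioc_of_le hΔ] at hg ⊢
  refine hg.mono' ?_ ((ae_restrict_iff' measurableSet_Ioc).2 (ae_of_all _ fun ε hε => ?_))
  · refine (aemeasurable_restrict_of_antitoneOn measurableSet_Ioc ?_).aestronglyMeasurable
    intro ε hε ε' _ h
    exact logEntropy_anti (hfin ε hε.1) h
  · rw [Real.norm_of_nonneg (logEntropy_nonneg ε)]
    exact hbound ε hε

end Covering

/-! ### Lipschitz covariance and continuous paths -/

section Covariance

variable {T Ω' : Type*} [MeasurableSpace Ω'] {P' : Measure Ω'} {f : T → Ω' → ℝ}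

lemma sq_canonicalDist_eq_covFun (hf : IsGaussianProcess f P') (s t : T) :
    canonicalDist f P' s t ^ 2 = covFun f P' s s - 2 * covFun f P' s t + covFun f P' t t := by
  have h := integrable_mul_of_isGaussianProcess hf
  rw [sq_canonicalDist, covFun, covFun, covFun, ← integral_const_mul,
    ← integral_sub (h s s) ((h s t).const_mul 2), ← integral_add _ (h t t)]
  · congr 1
    ext ω
    ring
  · exact (h s s).sub ((h s t).const_mul 2)

lemma ofReal_abs_deviation_le_supDeviation {Ω : Type*} {k : ℕ} (F : Fin k → T → Ω → ℝ)
    (D : T → T → ℝ) {S : Set T} {x y : T} (hx : x ∈ S) (hy : y ∈ S) (ω : Ω) :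
    ENNReal.ofReal |deviation F D x y ω| ≤ supDeviation F D S ω :=
  le_iSup₂_of_le (f := fun x _ => ⨆ y ∈ S, ENNReal.ofReal |deviation F D x y ω|) x hx
    (le_iSup₂_of_le (f := fun y _ => ENNReal.ofReal |deviation F D x y ω|) y hy le_rfl)

variable [PseudoMetricSpace T]

/-- `D²` is `(C(s,s) - C(s,t)) + (C(t,t) - C(s,t))`. Each difference moves one coordinate only, by
`dist s t` in the product metric. -/
lemma sq_canonicalDist_le_mul_dist (hf : IsGaussianProcess f P') {L : ℝ≥0}
    (hL : LipschitzWith L fun p : T × T => covFun f P' p.1 p.2) (s t : T) :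
    canonicalDist f P' s t ^ 2 ≤ 2 * L * dist s t := by
  have h1 := hL.dist_le_mul (s, s) (s, t)
  have h2 := hL.dist_le_mul (t, t) (s, t)
  simp only [Prod.dist_eq, dist_self, Real.dist_eq] at h1 h2
  rw [max_eq_right dist_nonneg] at h1
  rw [max_eq_left dist_nonneg, dist_comm] at h2
  rw [sq_canonicalDist_eq_covFun hf]
  linarith [le_abs_self (covFun f P' s s - covFun f P' s t),
    le_abs_self (covFun f P' t t - covFun f P' s t)]

lemma continuous_sq_canonicalDist (hf : IsGaussianProcess f P') {L : ℝ≥0}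
    (hL : LipschitzWith L fun p : T × T => covFun f P' p.1 p.2) :
    Continuous fun p : T × T => canonicalDist f P' p.1 p.2 ^ 2 := by
  simp_rw [sq_canonicalDist_eq_covFun hf]
  have h := hL.continuous
  exact ((h.comp (continuous_fst.prodMk continuous_fst)).sub (h.const_mul 2)).add
    (h.comp (continuous_snd.prodMk continuous_snd))

/-- For continuous paths the supremum of the deviation is determined by a dense set. -/
lemma supDeviation_univ_eq_of_dense {Ω : Type*} {k : ℕ} (hk : 0 < k) {F : Fin k → T → Ω → ℝ}
    {D : T → T → ℝ} (hD : Continuous fun p : T × T => D p.1 p.2 ^ 2) {S : Set T} (hS : Dense S)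
    {ω : Ω} (hF : ∀ i, Continuous fun t => F i t ω) :
    supDeviation F D Set.univ ω = supDeviation F D S ω := by
  have hcont : Continuous fun p : T × T => ENNReal.ofReal |deviation F D p.1 p.2 ω| := by
    simp_rw [deviation_eq_average hk]
    refine ENNReal.continuous_ofReal.comp (continuous_abs.comp (continuous_const.mul
      (continuous_finsetSum _ fun i _ => ?_)))
    exact ((((hF i).comp continuous_fst).sub ((hF i).comp continuous_snd)).pow 2).sub hD
  refine le_antisymm ?_ ?_
  · refine iSup₂_le fun x _ => iSup₂_le fun y _ => ?_
    change ENNReal.ofReal |deviation F D x y ω| ≤ _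
    have hcl : IsClosed {p : T × T | ENNReal.ofReal |deviation F D p.1 p.2 ω| ≤
        supDeviation F D S ω} := isClosed_le hcont continuous_const
    have hsub : S ×ˢ S ⊆ {p : T × T | ENNReal.ofReal |deviation F D p.1 p.2 ω| ≤
        supDeviation F D S ω} := fun p hp =>
      ofReal_abs_deviation_le_supDeviation F D hp.1 hp.2 ω
    have hxy := closure_minimal hsub hcl ((hS.prod hS) (x, y))
    rw [Set.mem_ofPred_eq] at hxy
    exact hxy
  · exact iSup₂_le fun x _ => iSup₂_le fun y _ =>
      ofReal_abs_deviation_le_supDeviation F D (Set.mem_univ x) (Set.mem_univ y) ω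

end Covariance

end GPEmbedding

/-! ### The main theorem -/

theorem theorem2p7 :
    ∃ c : ℝ, 0 < c ∧
      ∀ (n k : ℕ) (_ : 0 < k) (T : Set (EuclideanSpace ℝ (Fin n))) (_ : IsCompact T)
        (Ω' : Type*) [MeasurableSpace Ω'] (P' : Measure Ω') [IsProbabilityMeasure P']
        (f : T → Ω' → ℝ) (_ : IsGaussianProcess f P') (_ : ∀ t, ∫ ω, f t ω ∂P' = 0)
        (_ : ∃ L : ℝ≥0, LipschitzWith L (fun p : T × T => GPEmbedding.covFun f P' p.1 p.2))
        (Ω : Type*) [MeasurableSpace Ω] (P : Measure Ω) [IsProbabilityMeasure P]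
        (F : Fin k → T → Ω → ℝ) (_ : GPEmbedding.IsIndepCopies F P f P')
        (D : T → T → ℝ) (_ : D = GPEmbedding.canonicalDist f P'),
        -- the right-hand side is well defined and finite
        BddAbove (Set.range fun p : T × T => D p.1 p.2) ∧
        (∀ ε : ℝ, 0 < ε → GPEmbedding.coveringNumber D ε < ⊤) ∧
        IntervalIntegrable (GPEmbedding.logEntropy D) volume 0 (GPEmbedding.diam D) ∧
        -- the bound over every countable set of parameters, for any version of the process
        (∀ S : Set T, S.Countable →
          ∫⁻ ω, GPEmbedding.supDeviation F D S ω ∂P ≤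
            ENNReal.ofReal (c * GPEmbedding.entropyBound D k)) ∧
        -- the bound over all of `T`, for the version with continuous sample paths
        ((∀ᵐ ω ∂P, ∀ i, Continuous fun t => F i t ω) →
          AEMeasurable (GPEmbedding.supDeviation F D Set.univ) P ∧
          ∫⁻ ω, GPEmbedding.supDeviation F D Set.univ ω ∂P ≤
            ENNReal.ofReal (c * GPEmbedding.entropyBound D k)) := by
  refine ⟨32 * GPEmbedding.maximalConst, by have := GPEmbedding.maximalConst_pos; positivity, ?_⟩
  intro n k hk T hT Ω' _ P' _ f hf h0 ⟨L, hL⟩ Ω _ P _ F hF D hD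
  subst hD
  obtain ⟨R, hR⟩ := hT.isBounded.exists_norm_le
  -- For empty `T` the bound `R` may be negative.
  have hR' : ∀ x ∈ T, ‖x‖ ≤ max R 0 := fun x hx => (hR x hx).trans (le_max_left _ _)
  have hsq := GPEmbedding.sq_canonicalDist_le_mul_dist hf hL
  have hL0 : (0 : ℝ) ≤ 2 * L := by positivity
  have hbdd : BddAbove (Set.range fun p : T × T => GPEmbedding.canonicalDist f P' p.1 p.2) := by
    refine ⟨√(2 * L * Metric.diam T), ?_⟩
    rintro _ ⟨p, rfl⟩
    refine Real.le_sqrt_of_sq_le ((hsq p.1 p.2).trans (mul_le_mul_of_nonneg_left ?_ hL0))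
    exact Metric.dist_le_diam_of_mem hT.isBounded p.1.2 p.2.2
  have hN : ∀ ε : ℝ, 0 < ε → GPEmbedding.coveringNumber (GPEmbedding.canonicalDist f P') ε < ⊤ :=
    fun ε hε => (GPEmbedding.coveringNumber_le_of_sq_le hL0 hR' hsq hε).trans_lt
      (ENat.natCast_lt_top _)
  have hint := GPEmbedding.intervalIntegrable_logEntropy hL0 (le_max_right R 0) hR' hsq
    (Real.iSup_nonneg fun p : T × T => GPEmbedding.canonicalDist_nonneg f P' p.1 p.2)
  have hcountable := fun (S : Set T) (hS : S.Countable) =>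
    GPEmbedding.lintegral_supDeviation_countable_le hf h0 hk hF hbdd hN hint hS
  refine ⟨hbdd, hN, hint, hcountable, fun hpaths => ?_⟩
  obtain ⟨S, hSc, hSd⟩ := TopologicalSpace.exists_countable_dense T
  -- The uncountable supremum agrees almost surely with one over a countable dense set, which yields
  -- both its measurability and its bound.
  have hae : GPEmbedding.supDeviation F (GPEmbedding.canonicalDist f P') S =ᵐ[P]
      GPEmbedding.supDeviation F (GPEmbedding.canonicalDist f P') Set.univ := by
    filter_upwards [hpaths] with ω hω
    exact (GPEmbedding.supDeviation_univ_eq_of_dense hk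
      (GPEmbedding.continuous_sq_canonicalDist hf hL) hSd hω).symm
  refine ⟨(GPEmbedding.aemeasurable_supDeviation hk hF _ hSc).congr hae, ?_⟩
  rw [← lintegral_congr_ae hae]
  exact hcountable S hSc
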